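/- Let $M$ be a closed (compact, boundaryless) smooth surface, $a<b$ real numbers, $\mathcal M=(a,b)\times M$, $\overline{\mathcal M}=[a,b]\times M$ and $M_1=\{b\}\times M$. Let $x^0$ be the coordinate on $[a,b]$, $(x^1,x^2)$ local coordinates on $M$ and $\partial_0,\partial_1,\partial_2$ the coordinate vector fields. Let $G$ be a Riemannian metric on $\overline{\mathcal M}$, smooth up to the boundary, of the form $G=dx^0\otimes dx^0+g_{x^0}$ with a smooth family of metrics $(g_t)_{t\in[a,b]}$ on $M$ (for instance a product metric, or the metric of a spherical shell in $\mathbb R^3$). Denote by $D$, $\operatorname{div}$, $\operatorname{grad}$, $\operatorname{Ric}$ the Levi-Civita connection, divergence, gradient and Ricci tensor of $G$, and write $C(Du\otimes Du)=(Du)^i_j(Du)^j_i$. Let $\gamma>1$, $k_0,c_\nu>0$. Let the body force $\mathbf b$ (a vector field) and the heat supply $r$ (a function) be of class $C^1(\mathcal M)\cap C^0(\overline{\mathcal M})$. Let $p\in C^2(\mathcal M)\cap C^1(\overline{\mathcal M})$, let $\rho$ (a function) and $u$ (a vector field) be of class $C^1(\overline{\mathcal M})$, and suppose $\rho>0$ and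 $u^0=G(u,\partial_0)\neq0$ on $\overline{\mathcal M}$. Let $s$ be the entropy, i.e. $p=A(s)\rho^\gamma$ on $\overline{\mathcal M}$ with $A(s)=k_0e^{s/c_\nu}$, and put $c^2=\gamma p/\rho$, $E=\tfrac12G(u,u)+\tfrac{c^2}{\gamma-1}$. Set \begin{align*} R_A&=D_uA(s)-\tfrac{\gamma-1}{\rho^{\gamma-1}}r, & R_E&=D_uE-G(\mathbf b,u)-r,\\ R_m&=\tfrac{D_up}{\gamma p}+\operatorname{div}u-\tfrac{\gamma-1}{c^2}r, & R_u&=D_uu+\tfrac{\operatorname{grad}p}{\rho}-\mathbf b . \end{align*} Let $L^0,L^1,L^2,L^3$ and $L_1,L_2,L_3$ be real-valued functions which may depend on the point $x\in\overline{\mathcal M}$: $L^0(x,\cdot)$ is a linear function on $\mathbb R$, continuous in $x\in\overline{\mathcal M}$; $L^1(x,\cdot),L^2(x,\cdot),L_1(x,\cdot),L_2(x,\cdot)$ are functions on $\mathbb R$ and $L^3(x,\cdot),L_3(x,\cdot)$ functions on $T_x\overline{\mathcal M}$, arbitrary except that $L^k(x,0)=0$ and $L_k(x,0)=0$ for $k=1,2,3$.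 Then $(p,\rho,u)$ solves the steady full Euler system \[ \operatorname{div}(\rho u\otimes u)+\operatorname{grad}p-\rho \mathbf b=0,\qquad \operatorname{div}(\rho u)=0,\qquad \operatorname{div}(\rho Eu)-\rho G(\mathbf b,u)-\rho r=0\qquad\text{in }\mathcal M \] if and only if \[ R_A=0,\qquad R_E=0,\qquad G(R_u,\partial_\alpha)=0\quad(\alpha=1,2)\qquad\text{in }\mathcal M, \] \begin{multline*} D_u\Big(\frac{D_up}{\gamma p}\Big)-\operatorname{div}\Big(\frac{\operatorname{grad}p}{\rho}\Big)-C(Du\otimes Du)-\operatorname{Ric}(u,u)-(\gamma-1)D_u\Big(\frac r{c^2}\Big)+\operatorname{div}\mathbf b\\ +L^0(R_m)+L^1(R_E)+L^2(R_A)+L^3(R_u)=0\qquad\text{in }\mathcal M, \end{multline*} and \[ R_m+L_1(R_E)+L_2(R_A)+L_3(R_u)=0\qquad\text{on }M_1 . \] -/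

import Mathlib

open Set Bundle
open scoped Manifold ContDiff Topology TensorProduct

noncomputable section

namespace EulerSlab

/-- Coordinate space `ℝ × ℝ²` of the three-dimensional manifold `ℝ × M`. -/
abbrev EX : Type := ℝ × EuclideanSpace ℝ (Fin 2)

/-- The smooth model of `ℝ × M`, for a surface `M`. -/
abbrev IX : ModelWithCorners ℝ EX (ModelProd ℝ (EuclideanSpace ℝ (Fin 2))) :=
  𝓘(ℝ, ℝ).prod (𝓡 2)

/-- The standard basis of the coordinate space. -/
def basisVec : Fin 3 → EX :=
  ![(1, 0), (0, EuclideanSpace.single 0 1), (0, EuclideanSpace.single 1 1)]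

/-- The `i`-th coordinate on the coordinate space. -/
def coordFun : Fin 3 → EX →L[ℝ] ℝ :=
  ![ContinuousLinearMap.fst ℝ ℝ (EuclideanSpace ℝ (Fin 2)),
    (EuclideanSpace.proj 0 : EuclideanSpace ℝ (Fin 2) →L[ℝ] ℝ) ∘L
      ContinuousLinearMap.snd ℝ ℝ (EuclideanSpace ℝ (Fin 2)),
    (EuclideanSpace.proj 1 : EuclideanSpace ℝ (Fin 2) →L[ℝ] ℝ) ∘L
      ContinuousLinearMap.snd ℝ ℝ (EuclideanSpace ℝ (Fin 2))]

/-- The closed slab `[a, b] × M`. -/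
def slab (a b : ℝ) (M : Type*) : Set (ℝ × M) := Icc a b ×ˢ univ

/-- The open slab `(a, b) × M`. -/
def openSlab (a b : ℝ) (M : Type*) : Set (ℝ × M) := Ioo a b ×ˢ univ

section

variable {M : Type*} [TopologicalSpace M] [ChartedSpace (EuclideanSpace ℝ (Fin 2)) M]

/-- The coordinate vector `∂_i` at `z`, `i = 0, 1, 2`, of the preferred coordinates
`(x⁰, x¹, x²)` around `z`: here `x⁰` is the coordinate of the interval and `(x¹, x²)` is the
preferred chart of `M`. (In Mathlib the tangent space at `z` is identified with the coordinate
space through the preferred chart at `z`.) -/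
def pd (z : ℝ × M) (i : Fin 3) : TangentSpace IX z := basisVec i

/-- The `i`-th component of a tangent vector at `z` with respect to `∂₀, ∂₁, ∂₂`. -/
def comp (z : ℝ × M) (i : Fin 3) : TangentSpace IX z →L[ℝ] ℝ := coordFun i

/-- A scalar field on `ℝ × M`; only its values on `[a, b] × M` matter. -/
abbrev ScalarField (M : Type*) : Type _ := ℝ × M → ℝ

/-- A vector field on `ℝ × M`; only its values on `[a, b] × M` matter. -/
abbrev VField (M : Type*) [TopologicalSpace M] [ChartedSpace (EuclideanSpace ℝ (Fin 2)) M] :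
    Type _ :=
  (z : ℝ × M) → TangentSpace IX z

/-- A contravariant tensor field of rank two on `ℝ × M`. -/
abbrev TField (M : Type*) [TopologicalSpace M] [ChartedSpace (EuclideanSpace ℝ (Fin 2)) M] :
    Type _ :=
  (z : ℝ × M) → TangentSpace IX z ⊗[ℝ] TangentSpace IX z

/-- The vector field as a map into the tangent bundle. -/
def VField.toBundle (u : VField M) (z : ℝ × M) : TangentBundle IX (ℝ × M) := ⟨z, u z⟩

/-- A Riemannian metric on `[a, b] × M`, smooth up to the boundary, for which `∂₀` is a unit field
orthogonal to the slices `{t} × M`; that is, `G = dx⁰ ⊗ dx⁰ + g_{x⁰}` for a smooth family of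
metrics `g_t` on `M`. This covers the metric product, and the warped products such as a spherical
shell in `ℝ³`. -/
structure SlabMetric (a b : ℝ) (M : Type*) [TopologicalSpace M]
    [ChartedSpace (EuclideanSpace ℝ (Fin 2)) M] [IsManifold (𝓡 2) ∞ M] where
  /-- the metric tensor -/
  inner : (z : ℝ × M) → TangentSpace IX z →L[ℝ] TangentSpace IX z →L[ℝ] ℝ
  symm : ∀ z ∈ slab a b M, ∀ v w : TangentSpace IX z, inner z v w = inner z w v
  pos : ∀ z ∈ slab a b M, ∀ v : TangentSpace IX z, v ≠ 0 → 0 < inner z v v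
  smooth : ContMDiffOn IX (IX.prod 𝓘(ℝ, EX →L[ℝ] EX →L[ℝ] ℝ)) ∞
    (fun z => TotalSpace.mk' (EX →L[ℝ] EX →L[ℝ] ℝ)
      (E := fun z : ℝ × M => TangentSpace IX z →L[ℝ] TangentSpace IX z →L[ℝ] ℝ) z (inner z))
    (slab a b M)
  inner_pd_zero : ∀ z ∈ slab a b M, ∀ v : TangentSpace IX z, inner z v (pd z 0) = comp z 0 v

/-- `[a, b] × M` in the preferred coordinates around `z`. -/
def coordSlab (a b : ℝ) (z : ℝ × M) : Set EX :=
  (extChartAt IX z).target ∩ (extChartAt IX z).symm ⁻¹' slab a b M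

/-- The partial derivative `∂_i f` in the preferred coordinates around `z`
(one-sided at the boundary of the slab). -/
def partialD (a b : ℝ) (z : ℝ × M) (i : Fin 3) (f : EX → ℝ) (y : EX) : ℝ :=
  fderivWithin ℝ f (coordSlab a b z) y (basisVec i)

/-- The derivative `D_u f = df(u)` of a scalar field (one-sided at the boundary of the slab). -/
def scalarD (a b : ℝ) (u : VField M) (f : ScalarField M) : ScalarField M := fun z =>
  mfderivWithin IX 𝓘(ℝ, ℝ) f (slab a b M) z (u z)

variable [IsManifold (𝓡 2) ∞ M]

/-- The coordinate vector `∂_i` at a point `x` of the preferred coordinates around `z`. -/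
def pdAround (z x : ℝ × M) (i : Fin 3) : TangentSpace IX x :=
  tangentCoordChange IX z x x (basisVec i)

/-- The `i`-th component of a tangent vector at `x` in the preferred coordinates around `z`. -/
def compAround (z x : ℝ × M) (i : Fin 3) : TangentSpace IX x →L[ℝ] ℝ :=
  coordFun i ∘L tangentCoordChange IX x z x

/-- The components `u^i` of a vector field in the preferred coordinates around `z`. -/
def vecCoord (u : VField M) (z : ℝ × M) (i : Fin 3) (y : EX) : ℝ :=
  compAround z ((extChartAt IX z).symm y) i (u ((extChartAt IX z).symm y))

/-- The components `T^{ij}` of a tensor field in the preferred coordinates around `z`. -/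
def tensorCoord (T : TField M) (z : ℝ × M) (i j : Fin 3) (y : EX) : ℝ :=
  LinearMap.mul' ℝ ℝ
    (TensorProduct.map (compAround z ((extChartAt IX z).symm y) i).toLinearMap
      (compAround z ((extChartAt IX z).symm y) j).toLinearMap (T ((extChartAt IX z).symm y)))

variable {a b : ℝ} (G : SlabMetric a b M)

/-- The matrix `G_{ij}` of the metric in the preferred coordinates around `z`. -/
def metricCoord (z : ℝ × M) (y : EX) : Matrix (Fin 3) (Fin 3) ℝ := fun i j =>
  G.inner ((extChartAt IX z).symm y) (pdAround z ((extChartAt IX z).symm y) i)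
    (pdAround z ((extChartAt IX z).symm y) j)

/-- The Christoffel symbols `Γ^k_{ij}` in the preferred coordinates around `z`. -/
def christoffel (z : ℝ × M) (k i j : Fin 3) (y : EX) : ℝ :=
  (1 / 2) * ∑ l, (metricCoord G z y)⁻¹ k l *
    (partialD a b z i (fun y' => metricCoord G z y' j l) y
      + partialD a b z j (fun y' => metricCoord G z y' i l) y
      - partialD a b z l (fun y' => metricCoord G z y' i j) y)

/-- The components `R_{ij}` of the Ricci tensor at `z`,
`R_{ij} = ∂_k Γ^k_{ij} - ∂_j Γ^k_{ik} + Γ^k_{kl} Γ^l_{ij} - Γ^k_{jl} Γ^l_{ik}`. -/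
def ricciCoord (z : ℝ × M) (i j : Fin 3) : ℝ :=
  let y := extChartAt IX z z
  ∑ k, (partialD a b z k (christoffel G z k i j) y
    - partialD a b z j (christoffel G z k i k) y
    + ∑ l, (christoffel G z k k l y * christoffel G z l i j y
      - christoffel G z k j l y * christoffel G z l i k y))

/-- `Ric(v, w)` at `z`. -/
def ricci (z : ℝ × M) (v w : TangentSpace IX z) : ℝ :=
  ∑ i, ∑ j, ricciCoord G z i j * comp z i v * comp z j w

/-- The covariant differential `Du` at `z`: `(Du)^i_j = ∂_j u^i + Γ^i_{jk} u^k`. -/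
def covDiff (u : VField M) (z : ℝ × M) : Matrix (Fin 3) (Fin 3) ℝ := fun i j =>
  let y := extChartAt IX z z
  partialD a b z j (vecCoord u z i) y + ∑ k, christoffel G z i j k y * vecCoord u z k y

/-- The covariant derivative `D_w u` of the vector field `u` with respect to `w`. -/
def covDeriv (w u : VField M) : VField M := fun z =>
  (∑ i, (∑ j, covDiff G u z i j * comp z j (w z)) • pd z i)

/-- The divergence of a vector field, `div u = (Du)^i_i`. -/
def dvg (u : VField M) : ScalarField M := fun z => ∑ i, covDiff G u z i i

/-- The contraction `(Du)^i_j (Du)^j_i` of `Du ⊗ Du`. -/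
def contractDD (u : VField M) : ScalarField M := fun z =>
  ∑ i, ∑ j, covDiff G u z i j * covDiff G u z j i

/-- The divergence of a contravariant tensor field of rank two,
`(div T)^i = ∂_j T^{ij} + Γ^i_{jk} T^{kj} + Γ^j_{jk} T^{ik}`. -/
def tensorDvg (T : TField M) : VField M := fun z =>
  let y := extChartAt IX z z
  (∑ i, (∑ j, (partialD a b z j (tensorCoord T z i j) y
    + ∑ k, (christoffel G z i j k y * tensorCoord T z k j y
      + christoffel G z j j k y * tensorCoord T z i k y))) • pd z i)

/-- The gradient of a scalar field, `(grad f)^i = G^{ij} ∂_j f`. -/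
def grad (f : ScalarField M) : VField M := fun z =>
  (∑ i, (∑ j, (metricCoord G z (extChartAt IX z z))⁻¹ i j *
    scalarD a b (fun x => pd x j) f z) • pd z i)

end

/-! ### The gas -/

/-- The function `A(s) = k₀ exp(s / c_ν)` in the constitutive relation `p = A(s) ρ^γ`. -/
def entropyA {M : Type*} (k₀ cν : ℝ) (s : ScalarField M) : ScalarField M := fun z =>
  k₀ * Real.exp (s z / cν)

/-- The square `c² = γ p / ρ` of the sonic speed. -/
def sonicSq {M : Type*} (γ : ℝ) (p ρ : ScalarField M) : ScalarField M := fun z => γ * p z / ρ z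

section

variable {M : Type*} [TopologicalSpace M] [ChartedSpace (EuclideanSpace ℝ (Fin 2)) M]
  [IsManifold (𝓡 2) ∞ M] {a b : ℝ} (G : SlabMetric a b M)

/-- The Bernoulli function `E = |u|² / 2 + c² / (γ - 1)`. -/
def bernoulli (γ : ℝ) (p ρ : ScalarField M) (u : VField M) : ScalarField M := fun z =>
  (1 / 2) * G.inner z (u z) (u z) + sonicSq γ p ρ z / (γ - 1)

/-- The steady full Euler system in `(a, b) × M` with body force `f` and heat supply `r`:
conservation of momentum, mass and energy. -/
structure SolvesEuler (γ : ℝ) (f : VField M) (r : ScalarField M)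
    (p ρ : ScalarField M) (u : VField M) : Prop where
  momentum : ∀ z ∈ openSlab a b M,
    tensorDvg G (fun x => ρ x • (u x ⊗ₜ[ℝ] u x)) z + grad G p z - ρ z • f z = 0
  mass : ∀ z ∈ openSlab a b M, dvg G (fun x => ρ x • u x) z = 0
  energy : ∀ z ∈ openSlab a b M,
    dvg G (fun x => (ρ x * bernoulli G γ p ρ u x) • u x) z
      - ρ z * G.inner z (f z) (u z) - ρ z * r z = 0

/-- `D_u A(s) - (γ - 1) r / ρ^(γ - 1)`. -/
def resEntropy (a b γ k₀ cν : ℝ) (r ρ s : ScalarField M) (u : VField M) : ScalarField M := fun z =>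
  scalarD a b u (entropyA k₀ cν s) z - (γ - 1) / ρ z ^ (γ - 1) * r z

/-- `D_u E - G(f, u) - r`. -/
def resBernoulli (γ : ℝ) (f : VField M) (r p ρ : ScalarField M) (u : VField M) :
    ScalarField M := fun z =>
  scalarD a b u (bernoulli G γ p ρ u) z - G.inner z (f z) (u z) - r z

/-- `D_u u + (grad p) / ρ - f`. -/
def resMomentum (f : VField M) (p ρ : ScalarField M) (u : VField M) : VField M := fun z =>
  covDeriv G u u z + (ρ z)⁻¹ • grad G p z - f z

/-- `D_u p / (γ p) + div u - (γ - 1) r / c²`. -/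
def resMass (γ : ℝ) (r p ρ : ScalarField M) (u : VField M) : ScalarField M := fun z =>
  scalarD a b u p z / (γ * p z) + dvg G u z - (γ - 1) / sonicSq γ p ρ z * r z

/-- The second-order expression in the pressure
`D_u (D_u p / (γ p)) - div ((grad p) / ρ) - C(Du ⊗ Du) - Ric(u, u) - (γ - 1) D_u (r / c²) + div f`,
where `C(Du ⊗ Du) = (Du)^i_j (Du)^j_i`. -/
def pressureOp (γ : ℝ) (f : VField M) (r p ρ : ScalarField M) (u : VField M) :
    ScalarField M := fun z =>
  scalarD a b u (fun x => scalarD a b u p x / (γ * p x)) z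
    - dvg G (fun x => (ρ x)⁻¹ • grad G p x) z
    - contractDD G u z - ricci G z (u z) (u z)
    - (γ - 1) * scalarD a b u (fun x => r x / sonicSq γ p ρ x) z
    + dvg G f z

/-- The decomposed system: transport equations for `A(s)` and `E`, the second-order equation for
the pressure and the tangential momentum equations in `(a, b) × M`, and the boundary condition
on `{b} × M`. `L0, L1, L2, L3` are the auxiliary functions in the pressure equation and
`K1, K2, K3` those in the boundary condition; all may depend on the point. -/
structure SolvesDecomposed (γ k₀ cν : ℝ) (f : VField M) (r : ScalarField M)
    (L0 : ℝ × M → ℝ →L[ℝ] ℝ) (L1 L2 : ℝ × M → ℝ → ℝ)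
    (L3 : (z : ℝ × M) → TangentSpace IX z → ℝ)
    (K1 K2 : ℝ × M → ℝ → ℝ) (K3 : (z : ℝ × M) → TangentSpace IX z → ℝ)
    (p ρ s : ScalarField M) (u : VField M) : Prop where
  entropy : ∀ z ∈ openSlab a b M, resEntropy a b γ k₀ cν r ρ s u z = 0
  bernoulli : ∀ z ∈ openSlab a b M, resBernoulli G γ f r p ρ u z = 0
  pressure : ∀ z ∈ openSlab a b M,
    pressureOp G γ f r p ρ u z
      + L0 z (resMass G γ r p ρ u z)
      + L1 z (resBernoulli G γ f r p ρ u z)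
      + L2 z (resEntropy a b γ k₀ cν r ρ s u z)
      + L3 z (resMomentum G f p ρ u z) = 0
  tangential : ∀ z ∈ openSlab a b M, ∀ α : Fin 2,
    G.inner z (resMomentum G f p ρ u z) (pd z α.succ) = 0
  boundary : ∀ x : M,
    resMass G γ r p ρ u (b, x)
      + K1 (b, x) (resBernoulli G γ f r p ρ u (b, x))
      + K2 (b, x) (resEntropy a b γ k₀ cν r ρ s u (b, x))
      + K3 (b, x) (resMomentum G f p ρ u (b, x)) = 0

end

end EulerSlab

end

/-!
By the product rule, the Euler system in divergence form says that the momentum, entropy and mass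
residuals `R_u`, `R_A`, `R_m` vanish; moreover `R_E = G(R_u, u) + ρ^(γ-1)/(γ-1) * R_A`, so that,
since `u⁰ ≠ 0`, the equations `R_A = R_E = G(R_u, ∂_α) = 0` already force `R_u = 0`.

The point is to recover `R_m = 0`. Although `u` is only of class `C¹`, the momentum equation makes
`D_u u` of class `C¹`, and then `div u` is differentiable along the streamlines, with
`D_u (div u) = div (D_u u) - C(Du ⊗ Du) - Ric(u, u)`. Hence the derivative of `R_m` along a
streamline is the second order operator acting on `p`, and the pressure equation becomes the linear
transport equation `D_u R_m + L⁰(R_m) = 0` with `R_m = 0` on `M₁`. The flow is transversal to the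
slices `{t} × M`, so on the compact slab a weighted maximum principle gives `R_m = 0`.
-/

noncomputable section

namespace EulerSlab

section Calculus

variable {E : Type*} [NormedAddCommGroup E] [NormedSpace ℝ E]

theorem tendsto_diffQuot_of_hasStrictFDerivAt {F ι : Type*} [NormedAddCommGroup F]
    [NormedSpace ℝ F] {V : E → F} {V' : E →L[ℝ] F} {y e : E} (hV : HasStrictFDerivAt V V' y)
    {l : Filter ι} {x : ι → E} {h : ι → ℝ} (hx : Filter.Tendsto x l (𝓝 y))
    (hh : Filter.Tendsto h l (𝓝[≠] 0)) :
    Filter.Tendsto (fun i => (h i)⁻¹ • (V (x i + h i • e) - V (x i))) l (𝓝 (V' e)) := by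
  have hne : ∀ᶠ i in l, h i ≠ 0 := hh.eventually self_mem_nhdsWithin
  have hshift : Filter.Tendsto (fun i => x i + h i • e) l (𝓝 y) := by
    simpa using hx.add ((hh.mono_right nhdsWithin_le_nhds).smul_const e)
  have hsmall : (fun i => (h i)⁻¹ • (V (x i + h i • e) - V (x i) - V' (h i • e)))
      =o[l] fun _ => (1 : ℝ) := by
    have hstrict := (Asymptotics.isBigO_refl (fun i => (h i)⁻¹) l).smul_isLittleO
      (hV.isLittleO.comp_tendsto (hshift.prodMk_nhds hx))
    simp only [Function.comp_def, add_sub_cancel_left] at hstrict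
    refine hstrict.trans_isBigO (.of_bound ‖e‖ (hne.mono fun i hi => ?_))
    rw [smul_smul, inv_mul_cancel₀ hi, one_smul, norm_one, mul_one]
  have hlim := ((Asymptotics.isLittleO_one_iff ℝ).1 hsmall).add_const (V' e)
  rw [zero_add] at hlim
  refine hlim.congr' (hne.mono fun i hi => ?_)
  rw [map_smul, smul_sub, smul_smul, inv_mul_cancel₀ hi, one_smul, sub_add_cancel]

/-- Only the first derivative of `U` exists; the difference quotients of `U` in the direction `e`
converge, together with their derivatives along the integral curve. -/
theorem hasDerivAt_fderiv_integralCurve {U A : E → E} {A' : E →L[ℝ] E} {X : ℝ → E}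
    (hU : ContDiffAt ℝ 1 U (X 0)) (hA : HasStrictFDerivAt A A' (X 0))
    (hAU : ∀ᶠ x in 𝓝 (X 0), A x = fderiv ℝ U x (U x))
    (hX : ∀ᶠ t in 𝓝 (0 : ℝ), HasDerivAt X (U (X t)) t) (e : E) :
    HasDerivAt (fun t => fderiv ℝ U (X t) e)
      (A' e - fderiv ℝ U (X 0) (fderiv ℝ U (X 0) e)) 0 := by
  have hXc : ContinuousAt X 0 := hX.self_of_nhds.continuousAt
  have hUd : ∀ᶠ x in 𝓝 (X 0), DifferentiableAt ℝ U x :=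
    (hU.eventually (by simp)).mono fun x hx => hx.differentiableAt one_ne_zero
  have hU' : ContinuousAt (fderiv ℝ U) (X 0) :=
    (hU.fderiv_right (m := 0) (by norm_num)).continuousAt
  have hbase : Filter.Tendsto (fun q : ℝ × ℝ => X q.2) (𝓝[≠] 0 ×ˢ 𝓝 0) (𝓝 (X 0)) :=
    hXc.tendsto.comp Filter.tendsto_snd
  have hshift : Filter.Tendsto (fun q : ℝ × ℝ => X q.2 + q.1 • e)
      (𝓝[≠] 0 ×ˢ 𝓝 0) (𝓝 (X 0)) := by
    simpa using hbase.add
      ((Filter.tendsto_fst.mono_right (nhdsWithin_le_nhds (s := {0}ᶜ))).smul_const e)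
  let quot' : ℝ → ℝ → E := fun h t => h⁻¹ • (A (X t + h • e) - A (X t))
    - fderiv ℝ U (X t + h • e) (h⁻¹ • (U (X t + h • e) - U (X t)))
  refine hasDerivAt_of_tendstoUniformlyOnFilter (l := 𝓝[≠] (0 : ℝ))
    (f := fun h t => h⁻¹ • (U (X t + h • e) - U (X t))) (f' := quot')
    (g' := fun _ => A' e - fderiv ℝ U (X 0) (fderiv ℝ U (X 0) e)) ?_ ?_ ?_
  · have hlim : Filter.Tendsto (fun q : ℝ × ℝ => quot' q.1 q.2) (𝓝[≠] 0 ×ˢ 𝓝 0)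
        (𝓝 (A' e - fderiv ℝ U (X 0) (fderiv ℝ U (X 0) e))) :=
      (tendsto_diffQuot_of_hasStrictFDerivAt hA hbase Filter.tendsto_fst).sub
        ((isBoundedBilinearMap_apply.continuous.tendsto _).comp
          ((hU'.tendsto.comp hshift).prodMk_nhds (tendsto_diffQuot_of_hasStrictFDerivAt
            (hU.hasStrictFDerivAt one_ne_zero) hbase Filter.tendsto_fst)))
    rw [tendstoUniformlyOnFilter_iff_tendsto]
    exact (tendsto_const_nhds.prodMk_nhds hlim).mono_right (nhds_le_uniformity _)
  · filter_upwards [hshift.eventually hUd, hbase.eventually hUd, hshift.eventually hAU,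
      hbase.eventually hAU, Filter.tendsto_snd.eventually hX] with q hUs hUb hAs hAb hXq
    have hquot := ((hUs.hasFDerivAt.comp_hasDerivAt q.2 (hXq.add_const _)).sub
      (hUb.hasFDerivAt.comp_hasDerivAt q.2 hXq)).const_smul q.1⁻¹
    refine hquot.congr_deriv ?_
    simp only [quot', hAs, hAb, map_smul, map_sub, smul_sub]
    abel
  · filter_upwards [hXc.eventually hUd] with t ht
    simpa using (ht.hasFDerivAt.hasLineDerivAt e).tendsto_slope_zero

/-- The covariant differential `v ↦ DU(v) + Γ(v, U)` of a field `U` on the set `s`, for the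
connection with Christoffel map `Γ`. -/
def covariantFDeriv (Γ : E → E →L[ℝ] E →L[ℝ] E) (s : Set E) (U : E → E) (x : E) : E →L[ℝ] E :=
  fderivWithin ℝ U s x + (Γ x).flip (U x)

theorem covariantFDeriv_apply (Γ : E → E →L[ℝ] E →L[ℝ] E) (s : Set E) (U : E → E) (x v : E) :
    covariantFDeriv Γ s U x v = fderivWithin ℝ U s x v + Γ x v (U x) := rfl

/-- The Jacobi operator `v ↦ R(v, u)u` at `x`, for the connection with Christoffel map `Γ`; its
trace is `Ric(u, u)`. -/
def jacobiOp (Γ : E → E →L[ℝ] E →L[ℝ] E) (x u : E) : E →L[ℝ] E :=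
  ((fderiv ℝ Γ x).flip u).flip u - (fderiv ℝ Γ x u).flip u
    + (Γ x).flip (Γ x u u) - Γ x u ∘L (Γ x).flip u

theorem jacobiOp_apply (Γ : E → E →L[ℝ] E →L[ℝ] E) (x u v : E) :
    jacobiOp Γ x u v = fderiv ℝ Γ x v u u - fderiv ℝ Γ x u v u + Γ x v (Γ x u u)
      - Γ x u (Γ x v u) := rfl

set_option synthInstance.maxHeartbeats 400000 in
-- Normed-space instances on the iterated spaces `E →L[ℝ] E →L[ℝ] E` are slow to synthesize.
/-- For a torsion-free connection the failure of `D_u (∇U) = ∇(∇_U U) - (∇U)² - R(·, U)U` in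
coordinates is the commutator of `DU` and `Γ(U, ·)`. -/
theorem hasDerivAt_covariantFDeriv_integralCurve {Γ : E → E →L[ℝ] E →L[ℝ] E} {U F : E → E}
    {X : ℝ → E} (hΓ : ContDiffAt ℝ 1 Γ (X 0)) (hsymm : ∀ v w, Γ (X 0) v w = Γ (X 0) w v)
    (hU : ContDiffAt ℝ 1 U (X 0)) (hF : ContDiffAt ℝ 1 F (X 0))
    (hFU : ∀ᶠ x in 𝓝 (X 0), F x = covariantFDeriv Γ univ U x (U x))
    (hX : ∀ᶠ t in 𝓝 (0 : ℝ), HasDerivAt X (U (X t)) t) (e : E) :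
    HasDerivAt (fun t => covariantFDeriv Γ univ U (X t) e)
      ((covariantFDeriv Γ univ F (X 0)
        - covariantFDeriv Γ univ U (X 0) ∘L covariantFDeriv Γ univ U (X 0)
        - jacobiOp Γ (X 0) (U (X 0))
        + (fderiv ℝ U (X 0) ∘L Γ (X 0) (U (X 0)) - Γ (X 0) (U (X 0)) ∘L fderiv ℝ U (X 0))) e)
      0 := by
  simp only [covariantFDeriv_apply, fderivWithin_univ] at hFU ⊢
  have hΓ' := (hΓ.differentiableAt one_ne_zero).hasFDerivAt
  have hU' := (hU.differentiableAt one_ne_zero).hasFDerivAt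
  have hF' := (hF.differentiableAt one_ne_zero).hasFDerivAt
  have hA : ContDiffAt ℝ 1 (fun x => F x - Γ x (U x) (U x)) (X 0) :=
    hF.sub ((hΓ.clm_apply hU).clm_apply hU)
  have hA' := hF'.sub ((hΓ'.clm_apply hU').clm_apply hU')
  have hX0 := hX.self_of_nhds
  refine ((hasDerivAt_fderiv_integralCurve hU (hA.hasStrictFDerivAt' hA' one_ne_zero)
    (hFU.mono fun x hx => sub_eq_of_eq_add hx) hX e).add
    (((hΓ'.comp_hasDerivAt 0 hX0).clm_apply (hasDerivAt_const 0 e)).clm_apply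
      (hU'.comp_hasDerivAt 0 hX0))).congr_deriv ?_
  simp only [sub_apply, add_apply, covariantFDeriv_apply, jacobiOp_apply, fderivWithin_univ,
    ContinuousLinearMap.comp_apply, ContinuousLinearMap.flip_apply, Function.comp_apply,
    hFU.self_of_nhds, map_add, map_zero, add_zero]
  rw [hsymm (U (X 0)) e, hsymm (U (X 0)) (Γ (X 0) e (U (X 0)))]
  abel

theorem hasDerivAt_trace [FiniteDimensional ℝ E] {L : ℝ → E →L[ℝ] E} {L' : E →L[ℝ] E} {t : ℝ}
    (hL : ∀ e, HasDerivAt (fun t => L t e) (L' e) t) :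
    HasDerivAt (fun t => LinearMap.trace ℝ E (L t)) (LinearMap.trace ℝ E L') t := by
  let basis := Module.finBasis ℝ E
  simp only [LinearMap.trace_eq_matrix_trace ℝ basis, Matrix.trace, Matrix.diag,
    LinearMap.toMatrix_apply, ContinuousLinearMap.coe_coe]
  exact HasDerivAt.fun_sum fun i _ =>
    (basis.coord i).toContinuousLinearMap.hasFDerivAt.comp_hasDerivAt t (hL (basis i))

theorem hasDerivAt_trace_covariantFDeriv_integralCurve [FiniteDimensional ℝ E]
    {Γ : E → E →L[ℝ] E →L[ℝ] E} {U F : E → E}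
    {X : ℝ → E} (hΓ : ContDiffAt ℝ 1 Γ (X 0)) (hsymm : ∀ v w, Γ (X 0) v w = Γ (X 0) w v)
    (hU : ContDiffAt ℝ 1 U (X 0)) (hF : ContDiffAt ℝ 1 F (X 0))
    (hFU : ∀ᶠ x in 𝓝 (X 0), F x = covariantFDeriv Γ univ U x (U x))
    (hX : ∀ᶠ t in 𝓝 (0 : ℝ), HasDerivAt X (U (X t)) t) :
    HasDerivAt (fun t => LinearMap.trace ℝ E (covariantFDeriv Γ univ U (X t)))
      (LinearMap.trace ℝ E (covariantFDeriv Γ univ F (X 0))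
        - LinearMap.trace ℝ E ↑(covariantFDeriv Γ univ U (X 0) ∘L covariantFDeriv Γ univ U (X 0))
        - LinearMap.trace ℝ E (jacobiOp Γ (X 0) (U (X 0)))) 0 := by
  refine (hasDerivAt_trace
    (hasDerivAt_covariantFDeriv_integralCurve hΓ hsymm hU hF hFU hX)).congr_deriv ?_
  simp only [ContinuousLinearMap.toLinearMap_add, ContinuousLinearMap.toLinearMap_sub,
    ContinuousLinearMap.toLinearMap_comp, map_add, map_sub,
    LinearMap.trace_comp_comm' (fderiv ℝ U (X 0) : E →ₗ[ℝ] E), sub_self, add_zero]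

end Calculus

section ChangeOfVariables

variable {E : Type*} [NormedAddCommGroup E] [NormedSpace ℝ E]

/-- The Christoffel symbols of the first kind of a metric whose differential is `g'`. -/
def christoffelFirst (g' : E →L[ℝ] E →L[ℝ] E →L[ℝ] ℝ) (v w l : E) : ℝ :=
  (1 / 2) * (g' v w l + g' w v l - g' l v w)

theorem fderivWithin_pullback {g h : E → E →L[ℝ] E →L[ℝ] ℝ} {τ : E → E} {s t : Set E} {y : E}
    (hg : DifferentiableWithinAt ℝ g t (τ y)) (hh : DifferentiableWithinAt ℝ h s y)
    (hτ : ContDiffAt ℝ 2 τ y) (hs : UniqueDiffWithinAt ℝ s y) (hy : y ∈ s)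
    (hst : Filter.Tendsto τ (𝓝[s] y) (𝓝[t] (τ y)))
    (hgh : ∀ᶠ x in 𝓝[s] y, ∀ v w, h x v w = g (τ x) (fderiv ℝ τ x v) (fderiv ℝ τ x w))
    (e v w : E) :
    fderivWithin ℝ h s y e v w =
      fderivWithin ℝ g t (τ y) (fderiv ℝ τ y e) (fderiv ℝ τ y v) (fderiv ℝ τ y w)
        + g (τ y) (fderiv ℝ (fderiv ℝ τ) y e v) (fderiv ℝ τ y w)
        + g (τ y) (fderiv ℝ τ y v) (fderiv ℝ (fderiv ℝ τ) y e w) := by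
  have hτ' := (hτ.differentiableAt two_ne_zero).hasFDerivAt.hasFDerivWithinAt (s := s)
  have hτ'' := ((hτ.fderiv_right (m := 1) (by norm_num)).differentiableAt
    one_ne_zero).hasFDerivAt.hasFDerivWithinAt (s := s)
  have hgτ := HasFDerivWithinAt.comp_of_tendsto (G := E →L[ℝ] E →L[ℝ] ℝ) (g := g) y
    hg.hasFDerivWithinAt hτ' hst
  have hl := (hh.hasFDerivWithinAt.clm_apply (hasFDerivWithinAt_const v y s)).clm_apply
    (hasFDerivWithinAt_const w y s)
  have hr := (hgτ.clm_apply (hτ''.clm_apply (hasFDerivWithinAt_const v y s))).clm_apply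
    (hτ''.clm_apply (hasFDerivWithinAt_const w y s))
  have heq := hs.eq hl (hr.congr_of_eventuallyEq (hgh.mono fun x hx => hx v w)
    (hgh.self_of_nhdsWithin hy v w))
  simpa [add_comm, add_left_comm] using DFunLike.congr_fun heq e

theorem christoffelFirst_pullback {g h : E → E →L[ℝ] E →L[ℝ] ℝ} {τ : E → E} {s t : Set E} {y : E}
    (hg : DifferentiableWithinAt ℝ g t (τ y)) (hh : DifferentiableWithinAt ℝ h s y)
    (hτ : ContDiffAt ℝ 2 τ y) (hs : UniqueDiffWithinAt ℝ s y) (hy : y ∈ s)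
    (hst : Filter.Tendsto τ (𝓝[s] y) (𝓝[t] (τ y)))
    (hgh : ∀ᶠ x in 𝓝[s] y, ∀ v w, h x v w = g (τ x) (fderiv ℝ τ x v) (fderiv ℝ τ x w))
    (hsymm : ∀ v w, g (τ y) v w = g (τ y) w v) (v w l : E) :
    christoffelFirst (fderivWithin ℝ h s y) v w l =
      christoffelFirst (fderivWithin ℝ g t (τ y)) (fderiv ℝ τ y v) (fderiv ℝ τ y w) (fderiv ℝ τ y l)
        + g (τ y) (fderiv ℝ (fderiv ℝ τ) y v w) (fderiv ℝ τ y l) := by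
  have hcomm : ∀ v w, fderiv ℝ (fderiv ℝ τ) y v w = fderiv ℝ (fderiv ℝ τ) y w v :=
    fun v w => hτ.isSymmSndFDerivAt (by simp) v w
  simp only [christoffelFirst, fderivWithin_pullback hg hh hτ hs hy hst hgh]
  rw [hcomm l v, hcomm l w, hcomm w v, hsymm (fderiv ℝ τ y v), hsymm (fderiv ℝ τ y w)]
  ring

theorem covariantFDeriv_pullback {Γ Δ : E → E →L[ℝ] E →L[ℝ] E} {U V τ : E → E} {s t : Set E} {y : E}
    (hU : DifferentiableWithinAt ℝ U t (τ y)) (hV : DifferentiableWithinAt ℝ V s y)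
    (hτ : ContDiffAt ℝ 2 τ y) (hs : UniqueDiffWithinAt ℝ s y) (hy : y ∈ s)
    (hst : Filter.Tendsto τ (𝓝[s] y) (𝓝[t] (τ y)))
    (hUV : ∀ᶠ x in 𝓝[s] y, fderiv ℝ τ x (V x) = U (τ x))
    (hΓ : ∀ v w, fderiv ℝ τ y (Δ y v w) =
      Γ (τ y) (fderiv ℝ τ y v) (fderiv ℝ τ y w) + fderiv ℝ (fderiv ℝ τ) y v w) (v : E) :
    fderiv ℝ τ y (covariantFDeriv Δ s V y v) = covariantFDeriv Γ t U (τ y) (fderiv ℝ τ y v) := by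
  have hτ' := (hτ.differentiableAt two_ne_zero).hasFDerivAt.hasFDerivWithinAt (s := s)
  have hτ'' := ((hτ.fderiv_right (m := 1) (by norm_num)).differentiableAt
    one_ne_zero).hasFDerivAt.hasFDerivWithinAt (s := s)
  have heq := hs.eq (hτ''.clm_apply hV.hasFDerivWithinAt)
    ((hU.hasFDerivWithinAt.comp_of_tendsto y hτ' hst).congr_of_eventuallyEq hUV
      (hUV.self_of_nhdsWithin hy))
  have hderiv : fderiv ℝ τ y (fderivWithin ℝ V s y v) + fderiv ℝ (fderiv ℝ τ) y v (V y) =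
      fderivWithin ℝ U t (τ y) (fderiv ℝ τ y v) := DFunLike.congr_fun heq v
  rw [covariantFDeriv_apply, covariantFDeriv_apply, map_add, hΓ, hUV.self_of_nhdsWithin hy,
    ← hderiv]
  abel

end ChangeOfVariables

section ModelSpace

theorem coordFun_basisVec (i j : Fin 3) : coordFun i (basisVec j) = if i = j then 1 else 0 := by
  fin_cases i <;> fin_cases j <;> simp [coordFun, basisVec]

theorem sum_coordFun_smul_basisVec (v : EX) : ∑ i, coordFun i v • basisVec i = v := by
  rw [Fin.sum_univ_three]
  apply Prod.ext
  · simp [coordFun, basisVec]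
  · ext k
    fin_cases k <;> simp [coordFun, basisVec]

theorem coordFun_sum_smul_basisVec (c : Fin 3 → ℝ) (k : Fin 3) :
    coordFun k (∑ i, c i • basisVec i) = c k := by
  simp [map_sum, coordFun_basisVec]

theorem ext_coordFun {v w : EX} (h : ∀ i, coordFun i v = coordFun i w) : v = w := by
  rw [← sum_coordFun_smul_basisVec v, ← sum_coordFun_smul_basisVec w]
  simp only [h]

theorem map_eq_sum_coordFun {F : Type*} [NormedAddCommGroup F] [NormedSpace ℝ F]
    (L : EX →L[ℝ] F) (v : EX) : L v = ∑ i, coordFun i v • L (basisVec i) := by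
  conv_lhs => rw [← sum_coordFun_smul_basisVec v]
  simp only [map_sum, map_smul]

theorem ext_basisVec {F : Type*} [NormedAddCommGroup F] [NormedSpace ℝ F] {B C : EX →L[ℝ] F}
    (h : ∀ i, B (basisVec i) = C (basisVec i)) : B = C := by
  refine ContinuousLinearMap.ext fun v => ?_
  rw [map_eq_sum_coordFun B v, map_eq_sum_coordFun C v]
  simp only [h]

theorem bilin_eq_sum_coordFun {F : Type*} [NormedAddCommGroup F] [NormedSpace ℝ F]
    (B : EX →L[ℝ] EX →L[ℝ] F) (v w : EX) :
    B v w = ∑ i, ∑ j, (coordFun i v * coordFun j w) • B (basisVec i) (basisVec j) := by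
  rw [map_eq_sum_coordFun B v, sum_apply]
  refine Finset.sum_congr rfl fun i _ => ?_
  rw [smul_apply, map_eq_sum_coordFun (B (basisVec i)) w, Finset.smul_sum]
  simp only [smul_smul]

/-- The vectors `basisVec i` as a `Module.Basis`. -/
def stdBasis : Module.Basis (Fin 3) ℝ EX :=
  .ofEquivFun
    { toFun := fun v i => coordFun i v
      invFun := fun c => ∑ i, c i • basisVec i
      map_add' := fun v w => funext fun i => map_add (coordFun i) v w
      map_smul' := fun c v => funext fun i => map_smul (coordFun i) c v
      left_inv := sum_coordFun_smul_basisVec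
      right_inv := fun c => funext (coordFun_sum_smul_basisVec c) }

theorem stdBasis_apply (i : Fin 3) : stdBasis i = basisVec i := by
  simp [stdBasis, Module.Basis.coe_ofEquivFun, Pi.single_apply]

theorem trace_eq_sum_coordFun (L : EX →L[ℝ] EX) :
    LinearMap.trace ℝ EX L = ∑ i, coordFun i (L (basisVec i)) := by
  rw [LinearMap.trace_eq_matrix_trace ℝ stdBasis, Matrix.trace]
  refine Finset.sum_congr rfl fun i _ => ?_
  rw [Matrix.diag_apply, LinearMap.toMatrix_apply, stdBasis_apply]
  rfl

theorem trace_comp_eq_sum (L K : EX →L[ℝ] EX) :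
    LinearMap.trace ℝ EX (L ∘L K) =
      ∑ i, ∑ j, coordFun i (L (basisVec j)) * coordFun j (K (basisVec i)) := by
  rw [trace_eq_sum_coordFun]
  refine Finset.sum_congr rfl fun i _ => ?_
  rw [ContinuousLinearMap.comp_apply, map_eq_sum_coordFun L (K (basisVec i)), map_sum]
  simp only [map_smul, smul_eq_mul, mul_comm]

theorem trace_eq_of_semiconj {L K T S : EX →L[ℝ] EX} (hTS : ∀ v, T (S v) = v)
    (hLK : ∀ v, T (K v) = L (T v)) : LinearMap.trace ℝ EX K = LinearMap.trace ℝ EX L := by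
  have hTS' : T.toLinearMap ∘ₗ S.toLinearMap = LinearMap.id := LinearMap.ext hTS
  have hST : S.toLinearMap ∘ₗ T.toLinearMap = LinearMap.id :=
    (LinearMap.comp_eq_id_comm ℝ EX).1 hTS'
  have hLK' : T.toLinearMap ∘ₗ K.toLinearMap = L.toLinearMap ∘ₗ T.toLinearMap := LinearMap.ext hLK
  calc LinearMap.trace ℝ EX K
      = LinearMap.trace ℝ EX (S.toLinearMap ∘ₗ T.toLinearMap ∘ₗ K.toLinearMap) := by
        rw [← LinearMap.comp_assoc, hST, LinearMap.id_comp]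
    _ = LinearMap.trace ℝ EX ((L.toLinearMap ∘ₗ T.toLinearMap) ∘ₗ S.toLinearMap) := by
        rw [hLK', LinearMap.trace_comp_comm']
    _ = LinearMap.trace ℝ EX L := by rw [LinearMap.comp_assoc, hTS', LinearMap.comp_id]

end ModelSpace

section SlabCharts

variable {M : Type*} [TopologicalSpace M] [ChartedSpace (EuclideanSpace ℝ (Fin 2)) M] {a b : ℝ}

theorem openSlab_subset_slab {M : Type*} : openSlab a b M ⊆ slab a b M :=
  prod_mono Ioo_subset_Icc_self Subset.rfl

theorem isOpen_openSlab {M : Type*} [TopologicalSpace M] : IsOpen (openSlab a b M) :=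
  isOpen_Ioo.prod isOpen_univ

theorem slab_mem_nhds {M : Type*} [TopologicalSpace M] {x : ℝ × M} (hx : x ∈ openSlab a b M) :
    slab a b M ∈ 𝓝 x :=
  Filter.mem_of_superset (isOpen_openSlab.mem_nhds hx) openSlab_subset_slab

theorem slab_subset_closure_openSlab {M : Type*} [TopologicalSpace M] (hab : a < b) :
    slab a b M ⊆ closure (openSlab a b M) := by
  rw [openSlab, closure_prod_eq, closure_Ioo hab.ne, closure_univ]
  exact Subset.rfl

theorem extChartAt_symm_fst (z : ℝ × M) (y : EX) : ((extChartAt IX z).symm y).1 = y.1 := by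
  rw [extChartAt_prod, extChartAt_model_space_eq_id]
  rfl

theorem coordSlab_eq (a b : ℝ) (z : ℝ × M) :
    coordSlab a b z = Icc a b ×ˢ (extChartAt (𝓡 2) z.2).target := by
  ext y
  simp only [coordSlab, slab, mem_inter_iff, mem_preimage, mem_prod, mem_univ, and_true,
    extChartAt_symm_fst]
  rw [extChartAt_prod, extChartAt_model_space_eq_id, PartialEquiv.prod_target,
    PartialEquiv.refl_target, mem_prod]
  simp [and_comm]

theorem uniqueDiffOn_coordSlab (hab : a < b) (z : ℝ × M) : UniqueDiffOn ℝ (coordSlab a b z) := by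
  rw [coordSlab_eq]
  exact (uniqueDiffOn_Icc hab).prod (isOpen_extChartAt_target z.2).uniqueDiffOn

theorem extChartAt_mem_coordSlab {z x : ℝ × M} (hx : x ∈ slab a b M)
    (hxz : x ∈ (extChartAt IX z).source) : extChartAt IX z x ∈ coordSlab a b z :=
  ⟨(extChartAt IX z).map_source hxz, by rwa [mem_preimage, (extChartAt IX z).left_inv hxz]⟩

theorem uniqueDiffWithinAt_coordSlab (hab : a < b) {z x : ℝ × M} (hx : x ∈ slab a b M)
    (hxz : x ∈ (extChartAt IX z).source) :
    UniqueDiffWithinAt ℝ (coordSlab a b z) (extChartAt IX z x) :=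
  uniqueDiffOn_coordSlab hab z _ (extChartAt_mem_coordSlab hx hxz)

theorem target_inter_openSlab_mem_nhds {z : ℝ × M} (hz : z ∈ openSlab a b M) :
    (extChartAt IX z).target ∩ (extChartAt IX z).symm ⁻¹' openSlab a b M ∈
      𝓝 (extChartAt IX z z) := by
  refine Filter.inter_mem (extChartAt_target_mem_nhds z)
    ((continuousAt_extChartAt_symm z).preimage_mem_nhds ?_)
  rw [extChartAt_to_inv]
  exact isOpen_openSlab.mem_nhds hz

theorem coordSlab_mem_nhds {z x : ℝ × M} (hx : x ∈ openSlab a b M)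
    (hxz : x ∈ (extChartAt IX z).source) : coordSlab a b z ∈ 𝓝 (extChartAt IX z x) := by
  have h := (continuousAt_extChartAt_symm' hxz).preimage_mem_nhds (t := slab a b M)
    (by rw [(extChartAt IX z).left_inv hxz]; exact slab_mem_nhds hx)
  exact Filter.inter_mem (extChartAt_target_mem_nhds' ((extChartAt IX z).map_source hxz)) h

theorem tendsto_extChartAt_slab {z x : ℝ × M} (hxz : x ∈ (extChartAt IX z).source) :
    Filter.Tendsto (extChartAt IX z) (𝓝[slab a b M] x)
      (𝓝[coordSlab a b z] (extChartAt IX z x)) := by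
  refine tendsto_nhdsWithin_iff.2
    ⟨(continuousAt_extChartAt' hxz).tendsto.mono_left nhdsWithin_le_nhds, ?_⟩
  filter_upwards [self_mem_nhdsWithin, nhdsWithin_le_nhds (extChartAt_source_mem_nhds' hxz)]
    with x' hx' hxz' using extChartAt_mem_coordSlab hx' hxz'

theorem tendsto_extChartAt_symm_coordSlab {z x : ℝ × M} (hxz : x ∈ (extChartAt IX z).source) :
    Filter.Tendsto (extChartAt IX z).symm (𝓝[coordSlab a b z] (extChartAt IX z x))
      (𝓝[slab a b M] x) := by
  refine tendsto_nhdsWithin_iff.2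
    ⟨?_, Filter.mem_of_superset self_mem_nhdsWithin inter_subset_right⟩
  have h := (continuousAt_extChartAt_symm' hxz).tendsto.mono_left
    (nhdsWithin_le_nhds (s := coordSlab a b z))
  rwa [(extChartAt IX z).left_inv hxz] at h

theorem contMDiffWithinAt_of_eqOn_chart {F : Type*} [NormedAddCommGroup F] [NormedSpace ℝ F]
    {H : EX → F} {h : ℝ × M → F} {s : Set (ℝ × M)} {n : ℕ∞ω} {z : ℝ × M} (hz : z ∈ s)
    (hH : ContDiffWithinAt ℝ n H ((extChartAt IX z).target ∩ (extChartAt IX z).symm ⁻¹' s)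
      (extChartAt IX z z))
    (hh : ∀ x ∈ s, x ∈ (extChartAt IX z).source → h x = H (extChartAt IX z x)) :
    ContMDiffWithinAt IX 𝓘(ℝ, F) n h s z := by
  have hsource : (extChartAt IX z).source ∈ 𝓝[s] z :=
    mem_nhdsWithin_of_mem_nhds (extChartAt_source_mem_nhds z)
  have hcomp : ContMDiffWithinAt IX 𝓘(ℝ, F) n (H ∘ extChartAt IX z)
      (s ∩ (extChartAt IX z).source) z :=
    hH.contMDiffWithinAt.comp z (contMDiffAt_extChartAt (n := n)).contMDiffWithinAt
      fun x hx => ⟨(extChartAt IX z).map_source hx.2, by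
        rw [mem_preimage, (extChartAt IX z).left_inv hx.2]; exact hx.1⟩
  refine (hcomp.mono_of_mem_nhdsWithin
    (Filter.inter_mem self_mem_nhdsWithin hsource)).congr_of_eventuallyEq ?_
      (hh z hz (mem_extChartAt_source z))
  filter_upwards [self_mem_nhdsWithin, hsource] using hh

/-- The change from the preferred coordinates around `x` to those around `z`. -/
def transition (x z : ℝ × M) : EX → EX := extChartAt IX z ∘ (extChartAt IX x).symm

theorem transition_extChartAt {x z x' : ℝ × M} (hx' : x' ∈ (extChartAt IX x).source) :
    transition x z (extChartAt IX x x') = extChartAt IX z x' := by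
  rw [transition, Function.comp_apply, (extChartAt IX x).left_inv hx']

theorem transition_self (x z : ℝ × M) : transition x z (extChartAt IX x x) = extChartAt IX z x :=
  transition_extChartAt (mem_extChartAt_source x)

theorem tendsto_transition {x z : ℝ × M} (hxz : x ∈ (extChartAt IX z).source) :
    Filter.Tendsto (transition x z) (𝓝[coordSlab a b x] (extChartAt IX x x))
      (𝓝[coordSlab a b z] (transition x z (extChartAt IX x x))) := by
  rw [transition_self]
  exact (tendsto_extChartAt_slab hxz).comp
    (tendsto_extChartAt_symm_coordSlab (mem_extChartAt_source x))

theorem eventually_coordSlab_eq_extChartAt {x z : ℝ × M} (hxz : x ∈ (extChartAt IX z).source) :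
    ∀ᶠ y in 𝓝[coordSlab a b x] (extChartAt IX x x), ∃ x' ∈ slab a b M,
      x' ∈ (extChartAt IX x).source ∧ x' ∈ (extChartAt IX z).source ∧ extChartAt IX x x' = y := by
  have hsource := (tendsto_extChartAt_symm_coordSlab (a := a) (b := b)
    (mem_extChartAt_source (I := IX) x)).eventually
      (nhdsWithin_le_nhds (extChartAt_source_mem_nhds' hxz))
  filter_upwards [hsource, self_mem_nhdsWithin] with y hyz hy
  exact ⟨_, hy.2, (extChartAt IX x).map_target hy.1, hyz, (extChartAt IX x).right_inv hy.1⟩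

variable [IsManifold (𝓡 2) ∞ M]

theorem fderiv_transition (x z x' : ℝ × M) :
    fderiv ℝ (transition x z) (extChartAt IX x x') = tangentCoordChange IX x z x' := by
  rw [tangentCoordChange_def, ModelWithCorners.Boundaryless.range_eq_univ, fderivWithin_univ]
  rfl

theorem contDiffAt_transition {x z : ℝ × M} (hxz : x ∈ (extChartAt IX z).source) :
    ContDiffAt ℝ ∞ (transition x z) (extChartAt IX x x) := by
  have h : extChartAt IX x x ∈ ((extChartAt IX x).symm ≫ extChartAt IX z).source := by
    rw [PartialEquiv.trans_source'', PartialEquiv.symm_symm, PartialEquiv.symm_target]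
    exact mem_image_of_mem _ ⟨mem_extChartAt_source x, hxz⟩
  have h1 := contDiffWithinAt_ext_coord_change (n := ∞) z x h
  rw [ModelWithCorners.Boundaryless.range_eq_univ] at h1
  exact h1.contDiffAt Filter.univ_mem

theorem hasFDerivAt_transition {x z : ℝ × M} (hxz : x ∈ (extChartAt IX z).source) :
    HasFDerivAt (transition x z) (tangentCoordChange IX x z x) (extChartAt IX x x) := by
  rw [← fderiv_transition]
  exact ((contDiffAt_transition hxz).differentiableAt (by simp)).hasFDerivAt

theorem tangentCoordChange_inv {x z x' : ℝ × M} (hx' : x' ∈ (extChartAt IX x).source)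
    (hz' : x' ∈ (extChartAt IX z).source) (v : EX) :
    tangentCoordChange IX x z x' (tangentCoordChange IX z x x' v) = v := by
  rw [tangentCoordChange_comp ⟨⟨hz', hx'⟩, hz'⟩, tangentCoordChange_self hz']

end SlabCharts

section ScalarFields

variable {M : Type*} [TopologicalSpace M] [ChartedSpace (EuclideanSpace ℝ (Fin 2)) M] {a b : ℝ}

/-- The scalar field `f` in the preferred coordinates around `z`. -/
def scalarRep (f : ScalarField M) (z : ℝ × M) (y : EX) : ℝ := f ((extChartAt IX z).symm y)

theorem scalarRep_extChartAt (f : ScalarField M) {z x : ℝ × M}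
    (hxz : x ∈ (extChartAt IX z).source) : scalarRep f z (extChartAt IX z x) = f x := by
  rw [scalarRep, (extChartAt IX z).left_inv hxz]

theorem scalarD_eq_fderivWithin_self {f : ScalarField M} (u : VField M) {z : ℝ × M}
    (hf : MDifferentiableWithinAt IX 𝓘(ℝ, ℝ) f (slab a b M) z) :
    scalarD a b u f z =
      fderivWithin ℝ (scalarRep f z) (coordSlab a b z) (extChartAt IX z z) (u z) := by
  have h : fderivWithin ℝ (writtenInExtChartAt IX 𝓘(ℝ, ℝ) z f)
      ((extChartAt IX z).symm ⁻¹' slab a b M ∩ range IX) (extChartAt IX z z) =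
      fderivWithin ℝ (scalarRep f z) (coordSlab a b z) (extChartAt IX z z) := by
    refine fderivWithin_congr_set ?_
    filter_upwards [extChartAt_target_mem_nhds z] with y hy
    refine propext ⟨fun h => ⟨hy, h.1⟩, fun h => ⟨h.2, by simp [mfld_simps]⟩⟩
  exact congrArg (fun L : EX →L[ℝ] ℝ => L (u z)) (hf.mfderivWithin.trans h)

variable [IsManifold (𝓡 2) ∞ M]

theorem contDiffOn_comp_extChartAt_symm {F : Type*} [NormedAddCommGroup F] [NormedSpace ℝ F]
    {f : ℝ × M → F} {s : Set (ℝ × M)} {n : ℕ∞ω} (hn : n ≤ ∞)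
    (hf : ContMDiffOn IX 𝓘(ℝ, F) n f s) (z : ℝ × M) :
    ContDiffOn ℝ n (fun y => f ((extChartAt IX z).symm y))
      ((extChartAt IX z).target ∩ (extChartAt IX z).symm ⁻¹' s) := by
  have hsymm : ContMDiffOn 𝓘(ℝ, EX) IX n (extChartAt IX z).symm (extChartAt IX z).target :=
    (contMDiffOn_extChartAt_symm (n := ∞) z).of_le hn
  exact (hf.comp (hsymm.mono inter_subset_left) fun y hy => hy.2).contDiffOn

theorem differentiableWithinAt_comp_extChartAt_symm {F : Type*} [NormedAddCommGroup F]
    [NormedSpace ℝ F] {f : ℝ × M → F} {z x : ℝ × M}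
    (hf : MDifferentiableWithinAt IX 𝓘(ℝ, F) f (slab a b M) x)
    (hxz : x ∈ (extChartAt IX z).source) :
    DifferentiableWithinAt ℝ (fun y => f ((extChartAt IX z).symm y)) (coordSlab a b z)
      (extChartAt IX z x) := by
  have hsymm : MDifferentiableWithinAt 𝓘(ℝ, EX) IX (extChartAt IX z).symm (coordSlab a b z)
      (extChartAt IX z x) :=
    (mdifferentiableOn_extChartAt_symm _ ((extChartAt IX z).map_source hxz)).mono
      inter_subset_left
  rw [← (extChartAt IX z).left_inv hxz] at hf
  exact (hf.comp _ hsymm inter_subset_right).differentiableWithinAt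

theorem scalarD_eq_fderivWithin (hab : a < b) {f : ScalarField M} (u : VField M) {z x : ℝ × M}
    (hf : MDifferentiableWithinAt IX 𝓘(ℝ, ℝ) f (slab a b M) x) (hx : x ∈ slab a b M)
    (hxz : x ∈ (extChartAt IX z).source) :
    scalarD a b u f x = fderivWithin ℝ (scalarRep f z) (coordSlab a b z) (extChartAt IX z x)
      (tangentCoordChange IX x z x (u x)) := by
  have hxx := mem_extChartAt_source (I := IX) x
  have hfz : HasFDerivWithinAt (scalarRep f z) (fderivWithin ℝ (scalarRep f z) (coordSlab a b z)
      (extChartAt IX z x)) (coordSlab a b z)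
      (transition x z (extChartAt IX x x)) := by
    rw [transition_self]
    exact (differentiableWithinAt_comp_extChartAt_symm hf hxz).hasFDerivWithinAt
  have hcomp := HasFDerivWithinAt.comp_of_tendsto _ hfz
    (hasFDerivAt_transition hxz).hasFDerivWithinAt (tendsto_transition hxz)
  have heq : ∀ x' ∈ (extChartAt IX x).source, x' ∈ (extChartAt IX z).source →
      scalarRep f x (extChartAt IX x x') =
        (scalarRep f z ∘ transition x z) (extChartAt IX x x') := fun x' hx' hz' => by
    rw [Function.comp_apply, transition_extChartAt hx', scalarRep_extChartAt f hx',
      scalarRep_extChartAt f hz']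
  have hfx := hcomp.congr_of_eventuallyEq ((eventually_coordSlab_eq_extChartAt hxz).mono <| by
    rintro _ ⟨x', -, hx', hz', rfl⟩
    exact heq x' hx' hz') (heq x hxx hxz)
  rw [scalarD_eq_fderivWithin_self u hf, hfx.fderivWithin (uniqueDiffWithinAt_coordSlab hab hx hxx)]
  rfl

end ScalarFields

section VectorFields

variable {M : Type*} [TopologicalSpace M] [ChartedSpace (EuclideanSpace ℝ (Fin 2)) M]
  [IsManifold (𝓡 2) ∞ M] {a b : ℝ}

/-- The vector field `u` in the preferred coordinates around `z`. -/
def vecRep (u : VField M) (z : ℝ × M) (y : EX) : EX :=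
  tangentCoordChange IX ((extChartAt IX z).symm y) z ((extChartAt IX z).symm y)
    (u ((extChartAt IX z).symm y))

theorem coordFun_vecRep (u : VField M) (z : ℝ × M) (i : Fin 3) (y : EX) :
    coordFun i (vecRep u z y) = vecCoord u z i y := rfl

theorem vecRep_extChartAt (u : VField M) {z x : ℝ × M} (hxz : x ∈ (extChartAt IX z).source) :
    vecRep u z (extChartAt IX z x) = tangentCoordChange IX x z x (u x) := by
  rw [vecRep, (extChartAt IX z).left_inv hxz]

theorem vecRep_self (u : VField M) (z : ℝ × M) : vecRep u z (extChartAt IX z z) = u z := by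
  rw [vecRep_extChartAt u (mem_extChartAt_source z)]
  exact tangentCoordChange_self (mem_extChartAt_source z)

theorem vecRep_smul (f : ScalarField M) (u : VField M) (z : ℝ × M) :
    vecRep (fun x => f x • u x) z = fun y => scalarRep f z y • vecRep u z y :=
  funext fun _ => map_smul _ _ _

theorem vecRep_sub (u v : VField M) (z : ℝ × M) :
    vecRep (fun x => u x - v x) z = fun y => vecRep u z y - vecRep v z y :=
  funext fun _ => map_sub _ _ _

theorem tangentCoordChange_vecRep (u : VField M) {x z x' : ℝ × M}
    (hx' : x' ∈ (extChartAt IX x).source) (hz' : x' ∈ (extChartAt IX z).source) :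
    tangentCoordChange IX x z x' (vecRep u x (extChartAt IX x x')) =
      vecRep u z (extChartAt IX z x') := by
  rw [vecRep_extChartAt u hx', vecRep_extChartAt u hz']
  exact tangentCoordChange_comp ⟨⟨mem_extChartAt_source x', hx'⟩, hz'⟩

theorem mem_baseSet_iff {z x : ℝ × M} :
    x ∈ (trivializationAt EX (TangentSpace IX) z).baseSet ↔ x ∈ (extChartAt IX z).source := by
  rw [TangentBundle.trivializationAt_baseSet, extChartAt_source]

theorem contDiffOn_vecRep {u : VField M} {s : Set (ℝ × M)} {n : ℕ∞ω} (hn : n ≤ ∞)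
    [ContMDiffVectorBundle n EX (TangentSpace IX : ℝ × M → Type _) IX]
    (hu : ContMDiffOn IX IX.tangent n u.toBundle s) (z : ℝ × M) :
    ContDiffOn ℝ n (vecRep u z)
      ((extChartAt IX z).target ∩ (extChartAt IX z).symm ⁻¹' s) := by
  have hz : ContMDiffOn IX 𝓘(ℝ, EX) n (fun x => tangentCoordChange IX x z x (u x))
      (s ∩ (extChartAt IX z).source) := fun x hx =>
    ((trivializationAt EX (TangentSpace IX) z).contMDiffWithinAt_section _
      (mem_baseSet_iff.2 hx.2)).1 (hu.mono inter_subset_left x hx)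
  exact (contDiffOn_comp_extChartAt_symm hn hz z).mono fun y hy =>
    ⟨hy.1, hy.2, (extChartAt IX z).map_target hy.1⟩

theorem differentiableWithinAt_vecRep {u : VField M} {z x : ℝ × M}
    (hu : MDifferentiableWithinAt IX IX.tangent u.toBundle (slab a b M) x)
    (hxz : x ∈ (extChartAt IX z).source) :
    DifferentiableWithinAt ℝ (vecRep u z) (coordSlab a b z) (extChartAt IX z x) := by
  have hz : MDifferentiableWithinAt IX 𝓘(ℝ, EX) (fun x => tangentCoordChange IX x z x (u x))
      (slab a b M) x :=
    ((trivializationAt EX (TangentSpace IX) z).mdifferentiableWithinAt_section_iff IX u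
      (mem_baseSet_iff.2 hxz)).1 hu
  exact differentiableWithinAt_comp_extChartAt_symm (F := EX)
    (f := fun x => tangentCoordChange IX x z x (u x)) hz hxz

theorem contMDiffOn_tangentCoordChange (z : ℝ × M) (v : EX) :
    ContMDiffOn IX IX.tangent ∞ (VField.toBundle fun x => tangentCoordChange IX z x x v)
      (extChartAt IX z).source := by
  intro x hx
  refine ((trivializationAt EX (TangentSpace IX) z).contMDiffWithinAt_section _
    (mem_baseSet_iff.2 hx)).2 ?_
  exact (contMDiffOn_const (c := v) (s := (extChartAt IX z).source)).congr
    (fun x hx => tangentCoordChange_inv (mem_extChartAt_source x) hx v) x hx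

end VectorFields

section Metric

variable {M : Type*} [TopologicalSpace M] [ChartedSpace (EuclideanSpace ℝ (Fin 2)) M]
  [IsManifold (𝓡 2) ∞ M] {a b : ℝ} (G : SlabMetric a b M)

theorem contMDiffOn_inner_section {n : ℕ∞ω} (hn : n ≤ ∞)
    [ContMDiffVectorBundle n EX (TangentSpace IX : ℝ × M → Type _) IX] {u v : VField M}
    {s : Set (ℝ × M)} (hs : s ⊆ slab a b M)
    (hu : ContMDiffOn IX IX.tangent n u.toBundle s)
    (hv : ContMDiffOn IX IX.tangent n v.toBundle s) :
    ContMDiffOn IX 𝓘(ℝ, ℝ) n (fun x => G.inner x (u x) (v x)) s := by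
  intro x hx
  have h : ContMDiffWithinAt IX (IX.prod 𝓘(ℝ)) n
      (fun m => TotalSpace.mk' ℝ (E := Bundle.Trivial (ℝ × M) ℝ) m (G.inner m (u m) (v m))) s x :=
    ContMDiffWithinAt.clm_bundle_apply₂ (F₁ := EX) (F₂ := EX)
      ((G.smooth.mono hs x hx).of_le hn) (hu x hx) (hv x hx)
  exact (contMDiffWithinAt_totalSpace.1 h).2

/-- The metric in the preferred coordinates around `z`, as a bilinear form. -/
def metricForm (z : ℝ × M) (y : EX) : EX →L[ℝ] EX →L[ℝ] ℝ :=
  let x := (extChartAt IX z).symm y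
  let B : EX →L[ℝ] EX →L[ℝ] ℝ := G.inner x
  B.bilinearComp (tangentCoordChange IX z x x) (tangentCoordChange IX z x x)

theorem metricForm_basisVec (z : ℝ × M) (y : EX) (i j : Fin 3) :
    metricForm G z y (basisVec i) (basisVec j) = metricCoord G z y i j := rfl

theorem metricForm_extChartAt {z x : ℝ × M} (hxz : x ∈ (extChartAt IX z).source) (v w : EX) :
    metricForm G z (extChartAt IX z x) v w =
      G.inner x (tangentCoordChange IX z x x v) (tangentCoordChange IX z x x w) := by
  change G.inner ((extChartAt IX z).symm (extChartAt IX z x)) _ _ = _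
  rw [(extChartAt IX z).left_inv hxz]
  rfl

theorem metricForm_self (z : ℝ × M) (v w : TangentSpace IX z) :
    metricForm G z (extChartAt IX z z) v w = G.inner z v w := by
  have hzz := mem_extChartAt_source (I := IX) z
  have h : ∀ e : EX, tangentCoordChange IX z z z e = e := fun e => tangentCoordChange_self hzz
  exact (metricForm_extChartAt G hzz v w).trans
    (congrArg₂ (fun p q : EX => G.inner z p q) (h v) (h w))

theorem metricForm_vecRep (u v : VField M) (z : ℝ × M) {x : ℝ × M}
    (hxz : x ∈ (extChartAt IX z).source) :
    metricForm G z (extChartAt IX z x) (vecRep u z (extChartAt IX z x))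
      (vecRep v z (extChartAt IX z x)) = G.inner x (u x) (v x) := by
  have h : ∀ w : VField M, tangentCoordChange IX z x x (vecRep w z (extChartAt IX z x)) = w x :=
    fun w => (tangentCoordChange_vecRep w hxz (mem_extChartAt_source x)).trans (vecRep_self w x)
  exact (metricForm_extChartAt G hxz _ _).trans
    (congrArg₂ (fun p q : EX => G.inner x p q) (h u) (h v))

theorem metricForm_transition {x z x' : ℝ × M} (hx' : x' ∈ (extChartAt IX x).source)
    (hz' : x' ∈ (extChartAt IX z).source) (v w : EX) :
    metricForm G x (extChartAt IX x x') v w = metricForm G z (extChartAt IX z x')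
      (tangentCoordChange IX x z x' v) (tangentCoordChange IX x z x' w) := by
  have h : ∀ e, tangentCoordChange IX z x' x' (tangentCoordChange IX x z x' e) =
      tangentCoordChange IX x x' x' e := fun e =>
    tangentCoordChange_comp ⟨⟨hx', hz'⟩, mem_extChartAt_source x'⟩
  rw [metricForm_extChartAt G hx', metricForm_extChartAt G hz', h, h]

theorem contDiffOn_metricForm (z : ℝ × M) :
    ContDiffOn ℝ ∞ (metricForm G z) (coordSlab a b z) := by
  refine contDiffOn_clm_apply.2 fun v => contDiffOn_clm_apply.2 fun w => ?_
  have h := contMDiffOn_inner_section G le_rfl (s := slab a b M ∩ (extChartAt IX z).source)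
    inter_subset_left ((contMDiffOn_tangentCoordChange z v).mono inter_subset_right)
    ((contMDiffOn_tangentCoordChange z w).mono inter_subset_right)
  exact (contDiffOn_comp_extChartAt_symm le_rfl h z).mono fun y hy =>
    ⟨hy.1, hy.2, (extChartAt IX z).map_target hy.1⟩

variable {G}

theorem metricForm_symm {z : ℝ × M} {y : EX} (hy : y ∈ coordSlab a b z) (v w : EX) :
    metricForm G z y v w = metricForm G z y w v :=
  G.symm _ hy.2 _ _

theorem metricForm_pos {z : ℝ × M} {y : EX} (hy : y ∈ coordSlab a b z) {v : EX} (hv : v ≠ 0) :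
    0 < metricForm G z y v v := by
  refine G.pos _ hy.2 _ fun h => hv ?_
  rw [← tangentCoordChange_inv (mem_extChartAt_source _) ((extChartAt IX z).map_target hy.1) v]
  exact (congrArg _ h).trans (map_zero _)

theorem metricForm_ext {z : ℝ × M} {y : EX} (hy : y ∈ coordSlab a b z) {v w : EX}
    (h : ∀ l, metricForm G z y v l = metricForm G z y w l) : v = w := by
  by_contra hvw
  refine (metricForm_pos (G := G) hy (sub_ne_zero.2 hvw)).ne' ?_
  rw [map_sub (metricForm G z y), sub_apply, h, sub_self]

theorem det_metricCoord_ne_zero {z : ℝ × M} {y : EX} (hy : y ∈ coordSlab a b z) :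
    (metricCoord G z y).det ≠ 0 := by
  intro h
  obtain ⟨c, hc, hcG⟩ := Matrix.exists_vecMul_eq_zero_iff.2 h
  have hzero : (∑ i, c i • basisVec i) = 0 := metricForm_ext (G := G) hy fun l => by
    rw [map_eq_sum_coordFun (metricForm G z y (∑ i, c i • basisVec i)) l, map_zero, zero_apply]
    refine Finset.sum_eq_zero fun j _ => ?_
    have hj : ∑ i, c i * metricCoord G z y i j = 0 := congrFun hcG j
    simp [map_sum, sum_apply, metricForm_basisVec, hj]
  refine hc (funext fun i => ?_)
  rw [← coordFun_sum_smul_basisVec c i, hzero, map_zero, Pi.zero_apply]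

theorem metricForm_sum_inv {z : ℝ × M} {y : EX} (hy : y ∈ coordSlab a b z) (c : Fin 3 → ℝ)
    (l : Fin 3) : metricForm G z y (∑ i, (∑ j, (metricCoord G z y)⁻¹ i j * c j) • basisVec i)
      (basisVec l) = c l := by
  have hu : IsUnit (metricCoord G z y).det := (det_metricCoord_ne_zero hy).isUnit
  rw [metricForm_symm hy]
  simp only [map_sum, map_smul, metricForm_basisVec, smul_eq_mul]
  calc ∑ i, (∑ j, (metricCoord G z y)⁻¹ i j * c j) * metricCoord G z y l i
      = (metricCoord G z y).mulVec ((metricCoord G z y)⁻¹.mulVec c) l :=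
        Finset.sum_congr rfl fun i _ => mul_comm _ _
    _ = c l := by rw [Matrix.mulVec_mulVec, Matrix.mul_nonsing_inv _ hu, Matrix.one_mulVec]

variable (G)

theorem contDiffOn_metricCoord (z : ℝ × M) (i j : Fin 3) :
    ContDiffOn ℝ ∞ (fun y => metricCoord G z y i j) (coordSlab a b z) :=
  ((contDiffOn_metricForm G z).clm_apply contDiffOn_const).clm_apply contDiffOn_const

theorem contDiffOn_metricCoord_inv (z : ℝ × M) (i j : Fin 3) :
    ContDiffOn ℝ ∞ (fun y => (metricCoord G z y)⁻¹ i j) (coordSlab a b z) := by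
  have h := contDiffOn_metricCoord G z
  have hdet : ContDiffOn ℝ ∞ (fun y => (metricCoord G z y).det) (coordSlab a b z) := by
    simp only [Matrix.det_fin_three]
    fun_prop
  have hadj : ContDiffOn ℝ ∞ (fun y => (metricCoord G z y).adjugate i j) (coordSlab a b z) := by
    simp only [Matrix.adjugate_fin_three]
    fin_cases i <;> fin_cases j <;>
      simp only [Fin.isValue, Fin.reduceFinMk, Fin.zero_eta, Fin.mk_one, Matrix.of_apply,
        Matrix.cons_val', Matrix.cons_val_zero, Matrix.cons_val_one, Matrix.cons_val,
        Matrix.cons_val_fin_one] <;>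
      fun_prop
  simp only [Matrix.inv_def, Matrix.smul_apply, Ring.inverse_eq_inv', smul_eq_mul]
  exact (hdet.inv fun y hy => det_metricCoord_ne_zero hy).mul hadj

end Metric

section Christoffel

variable {M : Type*} [TopologicalSpace M] [ChartedSpace (EuclideanSpace ℝ (Fin 2)) M]
  [IsManifold (𝓡 2) ∞ M] {a b : ℝ} (G : SlabMetric a b M)

theorem christoffel_symm {z : ℝ × M} {y : EX} (hy : y ∈ coordSlab a b z) (k i j : Fin 3) :
    christoffel G z k i j y = christoffel G z k j i y := by
  have h : ∀ l, partialD a b z l (fun y' => metricCoord G z y' i j) y =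
      partialD a b z l (fun y' => metricCoord G z y' j i) y := fun l => by
    have heq : EqOn (fun y' => metricCoord G z y' i j) (fun y' => metricCoord G z y' j i)
        (coordSlab a b z) := fun y' hy' => metricForm_symm hy' (basisVec i) (basisVec j)
    exact DFunLike.congr_fun (fderivWithin_congr' heq hy) _
  simp only [christoffel, h, add_comm]

theorem contDiffOn_christoffel (hab : a < b) (z : ℝ × M) (k i j : Fin 3) :
    ContDiffOn ℝ 1 (christoffel G z k i j) (coordSlab a b z) := by
  have h : ∀ l i j, ContDiffOn ℝ 1 (partialD a b z l (fun y' => metricCoord G z y' i j))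
      (coordSlab a b z) := fun l i j =>
    ((contDiffOn_metricCoord G z i j).fderivWithin (uniqueDiffOn_coordSlab hab z) (m := 1)
      (by norm_cast)).clm_apply contDiffOn_const
  exact contDiffOn_const.mul (ContDiffOn.sum fun l _ =>
    ((contDiffOn_metricCoord_inv G z k l).of_le (by norm_cast)).mul
      (((h i j l).add (h j i l)).sub (h l i j)))

/-- The Christoffel symbols in the preferred coordinates around `z`, as a bilinear map. -/
def christoffelMap (z : ℝ × M) (y : EX) : EX →L[ℝ] EX →L[ℝ] EX :=
  ∑ k, ∑ i, ∑ j, (christoffel G z k i j y) •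
    (coordFun i).smulRight ((coordFun j).smulRight (basisVec k))

theorem christoffelMap_apply (z : ℝ × M) (y v w : EX) : christoffelMap G z y v w =
    ∑ k, (∑ i, ∑ j, christoffel G z k i j y * coordFun i v * coordFun j w) • basisVec k := by
  simp only [christoffelMap, sum_apply, smul_apply, ContinuousLinearMap.smulRight_apply,
    Finset.sum_smul, smul_smul, mul_assoc]

theorem christoffelMap_basisVec (z : ℝ × M) (y : EX) (i j : Fin 3) :
    christoffelMap G z y (basisVec i) (basisVec j) =
      ∑ k, christoffel G z k i j y • basisVec k := by
  simp only [christoffelMap_apply, coordFun_basisVec, mul_ite, mul_one, mul_zero,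
    Finset.sum_ite_eq', Finset.mem_univ, if_true]

theorem coordFun_christoffelMap (z : ℝ × M) (y v w : EX) (k : Fin 3) :
    coordFun k (christoffelMap G z y v w) =
      ∑ i, ∑ j, christoffel G z k i j y * coordFun i v * coordFun j w := by
  rw [christoffelMap_apply, coordFun_sum_smul_basisVec]

theorem contDiffOn_christoffelMap (hab : a < b) (z : ℝ × M) :
    ContDiffOn ℝ 1 (christoffelMap G z) (coordSlab a b z) := by
  refine contDiffOn_clm_apply.2 fun v => contDiffOn_clm_apply.2 fun w => ?_
  simp only [christoffelMap_apply]
  exact ContDiffOn.sum fun k _ => ContDiffOn.smul (ContDiffOn.sum fun i _ => ContDiffOn.sum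
    fun j _ => ((contDiffOn_christoffel G hab z k i j).mul contDiffOn_const).mul contDiffOn_const)
    contDiffOn_const

variable {G}

theorem christoffelMap_symm {z : ℝ × M} {y : EX} (hy : y ∈ coordSlab a b z) (v w : EX) :
    christoffelMap G z y v w = christoffelMap G z y w v := by
  refine ext_coordFun fun k => ?_
  rw [coordFun_christoffelMap, coordFun_christoffelMap, Finset.sum_comm]
  refine Finset.sum_congr rfl fun j _ => Finset.sum_congr rfl fun i _ => ?_
  rw [christoffel_symm G hy k i j, mul_right_comm]

theorem differentiableWithinAt_metricForm {z : ℝ × M} {y : EX} (hy : y ∈ coordSlab a b z) :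
    DifferentiableWithinAt ℝ (metricForm G z) (coordSlab a b z) y :=
  (contDiffOn_metricForm G z).differentiableOn (by simp) y hy

theorem fderivWithin_metricForm_apply (hab : a < b) {z : ℝ × M} {y : EX}
    (hy : y ∈ coordSlab a b z) (e v w : EX) :
    fderivWithin ℝ (metricForm G z) (coordSlab a b z) y e v w =
      fderivWithin ℝ (fun y' => metricForm G z y' v w) (coordSlab a b z) y e := by
  have h := ((differentiableWithinAt_metricForm (G := G) hy).hasFDerivWithinAt.clm_apply
    (hasFDerivWithinAt_const v y _)).clm_apply (hasFDerivWithinAt_const w y _)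
  rw [h.fderivWithin (uniqueDiffOn_coordSlab hab z y hy)]
  simp

theorem metricForm_christoffelMap (hab : a < b) {z : ℝ × M} {y : EX} (hy : y ∈ coordSlab a b z)
    (v w l : EX) : metricForm G z y (christoffelMap G z y v w) l =
      christoffelFirst (fderivWithin ℝ (metricForm G z) (coordSlab a b z) y) v w l := by
  set g' := fderivWithin ℝ (metricForm G z) (coordSlab a b z) y
  have hcoord : ∀ i j l, metricForm G z y (christoffelMap G z y (basisVec i) (basisVec j))
      (basisVec l) = christoffelFirst g' (basisVec i) (basisVec j) (basisVec l) := by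
    intro i j l
    have hΓ : christoffelMap G z y (basisVec i) (basisVec j) =
        ∑ k, (∑ m, (metricCoord G z y)⁻¹ k m *
          christoffelFirst g' (basisVec i) (basisVec j) (basisVec m)) • basisVec k := by
      rw [christoffelMap_basisVec]
      refine Finset.sum_congr rfl fun k _ => congrArg (· • basisVec k) ?_
      simp only [christoffel, Finset.mul_sum, christoffelFirst, g',
        fderivWithin_metricForm_apply hab hy, metricForm_basisVec, partialD]
      exact Finset.sum_congr rfl fun m _ => mul_left_comm _ _ _
    rw [hΓ, metricForm_sum_inv hy]
  have hlast : ∀ i j, metricForm G z y (christoffelMap G z y (basisVec i) (basisVec j)) =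
      (1 / 2 : ℝ) • (g' (basisVec i) (basisVec j) + g' (basisVec j) (basisVec i)
        - (g'.flip (basisVec i)).flip (basisVec j)) := fun i j => ext_basisVec (hcoord i j)
  have hmid : ∀ i, ((metricForm G z y).flip l).comp (christoffelMap G z y (basisVec i)) =
      (1 / 2 : ℝ) • ((g' (basisVec i)).flip l + (g'.flip (basisVec i)).flip l
        - g' l (basisVec i)) := fun i => ext_basisVec fun j => DFunLike.congr_fun (hlast i j) l
  have hfirst : ((metricForm G z y).flip l).comp ((christoffelMap G z y).flip w) =
      (1 / 2 : ℝ) • ((g'.flip w).flip l + (g' w).flip l - (g' l).flip w) :=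
    ext_basisVec fun i => DFunLike.congr_fun (hmid i) w
  exact DFunLike.congr_fun hfirst v

end Christoffel

section Connection

variable {M : Type*} [TopologicalSpace M] [ChartedSpace (EuclideanSpace ℝ (Fin 2)) M]
  [IsManifold (𝓡 2) ∞ M] {a b : ℝ} (G : SlabMetric a b M)

theorem fderivWithin_metricForm_eq (hab : a < b) {z : ℝ × M} {y : EX} (hy : y ∈ coordSlab a b z)
    (e v w : EX) :
    fderivWithin ℝ (metricForm G z) (coordSlab a b z) y e v w =
      metricForm G z y (christoffelMap G z y e v) w
        + metricForm G z y v (christoffelMap G z y e w) := by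
  have hswap : ∀ e v w, fderivWithin ℝ (metricForm G z) (coordSlab a b z) y e v w =
      fderivWithin ℝ (metricForm G z) (coordSlab a b z) y e w v := fun e v w => by
    have heq : EqOn (fun y' => metricForm G z y' v w) (fun y' => metricForm G z y' w v)
        (coordSlab a b z) := fun y' hy' => metricForm_symm hy' v w
    rw [fderivWithin_metricForm_apply hab hy, fderivWithin_metricForm_apply hab hy,
      fderivWithin_congr' heq hy]
  rw [metricForm_symm hy v, metricForm_christoffelMap hab hy, metricForm_christoffelMap hab hy,
    christoffelFirst, christoffelFirst, hswap v e w, hswap w e v, hswap e w v]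
  ring

theorem christoffelMap_transition (hab : a < b) {x z : ℝ × M} (hx : x ∈ slab a b M)
    (hxz : x ∈ (extChartAt IX z).source) (v w : EX) :
    fderiv ℝ (transition x z) (extChartAt IX x x)
        (christoffelMap G x (extChartAt IX x x) v w) =
      christoffelMap G z (transition x z (extChartAt IX x x))
        (fderiv ℝ (transition x z) (extChartAt IX x x) v)
        (fderiv ℝ (transition x z) (extChartAt IX x x) w)
      + fderiv ℝ (fderiv ℝ (transition x z)) (extChartAt IX x x) v w := by
  have hxx := mem_extChartAt_source (I := IX) x
  have hy := extChartAt_mem_coordSlab hx hxx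
  have hy' : transition x z (extChartAt IX x x) ∈ coordSlab a b z :=
    transition_self x z ▸ extChartAt_mem_coordSlab hx hxz
  have hform : ∀ᶠ y in 𝓝[coordSlab a b x] (extChartAt IX x x), ∀ v w, metricForm G x y v w =
      metricForm G z (transition x z y) (fderiv ℝ (transition x z) y v)
        (fderiv ℝ (transition x z) y w) := by
    filter_upwards [eventually_coordSlab_eq_extChartAt hxz]
    rintro _ ⟨x', -, hx', hz', rfl⟩ v w
    rw [fderiv_transition, transition_extChartAt hx', metricForm_transition G hx' hz']
  refine metricForm_ext (G := G) hy' fun l => ?_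
  obtain ⟨l, rfl⟩ : ∃ l', fderiv ℝ (transition x z) (extChartAt IX x x) l' = l :=
    ⟨tangentCoordChange IX z x x l, by rw [fderiv_transition, tangentCoordChange_inv hxx hxz]⟩
  rw [← hform.self_of_nhdsWithin hy, metricForm_christoffelMap hab hy, map_add, add_apply,
    metricForm_christoffelMap hab hy']
  exact christoffelFirst_pullback (differentiableWithinAt_metricForm hy')
    (differentiableWithinAt_metricForm hy) ((contDiffAt_transition hxz).of_le (by norm_cast))
    (uniqueDiffOn_coordSlab hab x _ hy) hy (tendsto_transition hxz) hform
    (metricForm_symm hy') v w l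

/-- The covariant differential `Du` in the preferred coordinates around `z`. -/
def covRep (u : VField M) (z : ℝ × M) : EX → EX →L[ℝ] EX :=
  covariantFDeriv (christoffelMap G z) (coordSlab a b z) (vecRep u z)

theorem covRep_transition (hab : a < b) {u : VField M} {x z : ℝ × M} (hx : x ∈ slab a b M)
    (hxz : x ∈ (extChartAt IX z).source)
    (hu : MDifferentiableWithinAt IX IX.tangent u.toBundle (slab a b M) x) (v : EX) :
    tangentCoordChange IX x z x (covRep G u x (extChartAt IX x x) v) =
      covRep G u z (extChartAt IX z x) (tangentCoordChange IX x z x v) := by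
  have hxx := mem_extChartAt_source (I := IX) x
  have hy := extChartAt_mem_coordSlab hx hxx
  have huz : DifferentiableWithinAt ℝ (vecRep u z) (coordSlab a b z)
      (transition x z (extChartAt IX x x)) :=
    (transition_self x z).symm ▸ differentiableWithinAt_vecRep hu hxz
  have hrep : ∀ᶠ y in 𝓝[coordSlab a b x] (extChartAt IX x x),
      fderiv ℝ (transition x z) y (vecRep u x y) = vecRep u z (transition x z y) := by
    filter_upwards [eventually_coordSlab_eq_extChartAt hxz]
    rintro _ ⟨x', -, hx', hz', rfl⟩
    rw [fderiv_transition, transition_extChartAt hx', tangentCoordChange_vecRep u hx' hz']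
  have h := covariantFDeriv_pullback huz (differentiableWithinAt_vecRep hu hxx)
    ((contDiffAt_transition hxz).of_le (by norm_cast)) (uniqueDiffOn_coordSlab hab x _ hy) hy
    (tendsto_transition hxz) hrep (christoffelMap_transition G hab hx hxz) v
  rwa [fderiv_transition, transition_self] at h

theorem covDiff_eq_coordFun (hab : a < b) {u : VField M} {z : ℝ × M} (hz : z ∈ slab a b M)
    (hu : MDifferentiableWithinAt IX IX.tangent u.toBundle (slab a b M) z) (i j : Fin 3) :
    covDiff G u z i j = coordFun i (covRep G u z (extChartAt IX z z) (basisVec j)) := by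
  have hzz := mem_extChartAt_source (I := IX) z
  have hcomp := (coordFun i).hasFDerivAt.comp_hasFDerivWithinAt _
    (differentiableWithinAt_vecRep hu hzz).hasFDerivWithinAt
  have hpartial : partialD a b z j (vecCoord u z i) (extChartAt IX z z) =
      coordFun i (fderivWithin ℝ (vecRep u z) (coordSlab a b z) (extChartAt IX z z)
        (basisVec j)) :=
    DFunLike.congr_fun (hcomp.fderivWithin (uniqueDiffWithinAt_coordSlab hab hz hzz)) (basisVec j)
  rw [covRep, covariantFDeriv_apply, map_add, coordFun_christoffelMap, covDiff, hpartial]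
  simp [coordFun_basisVec, coordFun_vecRep]

theorem covDeriv_eq_covRep (hab : a < b) (w : VField M) {u : VField M} {z : ℝ × M}
    (hz : z ∈ slab a b M)
    (hu : MDifferentiableWithinAt IX IX.tangent u.toBundle (slab a b M) z) :
    covDeriv G w u z = covRep G u z (extChartAt IX z z) (w z) := by
  refine ext_coordFun fun i => (coordFun_sum_smul_basisVec _ i).trans ?_
  rw [map_eq_sum_coordFun (covRep G u z _) (w z), map_sum]
  refine Finset.sum_congr rfl fun j _ => ?_
  rw [map_smul, smul_eq_mul, covDiff_eq_coordFun G hab hz hu, mul_comm]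
  rfl

theorem vecRep_covDeriv (hab : a < b) (w : VField M) {u : VField M} {x z : ℝ × M}
    (hx : x ∈ slab a b M) (hxz : x ∈ (extChartAt IX z).source)
    (hu : MDifferentiableWithinAt IX IX.tangent u.toBundle (slab a b M) x) :
    vecRep (covDeriv G w u) z (extChartAt IX z x) =
      covRep G u z (extChartAt IX z x) (vecRep w z (extChartAt IX z x)) := by
  rw [vecRep_extChartAt _ hxz, vecRep_extChartAt _ hxz, covDeriv_eq_covRep G hab w hx hu]
  exact covRep_transition G hab hx hxz hu (w x)

theorem dvg_eq_trace (hab : a < b) {u : VField M} {x z : ℝ × M}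
    (hx : x ∈ slab a b M) (hxz : x ∈ (extChartAt IX z).source)
    (hu : MDifferentiableWithinAt IX IX.tangent u.toBundle (slab a b M) x) :
    dvg G u x = LinearMap.trace ℝ EX (covRep G u z (extChartAt IX z x)) := by
  rw [← trace_eq_of_semiconj
    (tangentCoordChange_inv (mem_extChartAt_source x) hxz) (covRep_transition G hab hx hxz hu),
    trace_eq_sum_coordFun]
  exact Finset.sum_congr rfl fun i _ => covDiff_eq_coordFun G hab hx hu i i

theorem contractDD_eq_trace (hab : a < b) {u : VField M} {z : ℝ × M} (hz : z ∈ slab a b M)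
    (hu : MDifferentiableWithinAt IX IX.tangent u.toBundle (slab a b M) z) :
    contractDD G u z = LinearMap.trace ℝ EX
      ↑(covRep G u z (extChartAt IX z z) ∘L covRep G u z (extChartAt IX z z)) := by
  simp only [contractDD, covDiff_eq_coordFun G hab hz hu, trace_comp_eq_sum]

theorem continuousOn_covRep (hab : a < b) {u : VField M}
    (hu : ContMDiffOn IX IX.tangent 1 u.toBundle (slab a b M)) (z : ℝ × M) :
    ContinuousOn (covRep G u z) (coordSlab a b z) := by
  have hrep := contDiffOn_vecRep (by norm_cast) hu z
  have hflip : ContinuousOn (fun y => (christoffelMap G z y).flip) (coordSlab a b z) :=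
    (ContinuousLinearMap.flipₗᵢ ℝ EX EX EX).continuous.comp_continuousOn
      (contDiffOn_christoffelMap G hab z).continuousOn
  exact (hrep.continuousOn_fderivWithin (uniqueDiffOn_coordSlab hab z) le_rfl).add
    (hflip.clm_apply hrep.continuousOn)

theorem coordFun_fderiv_christoffelMap (hab : a < b) {z : ℝ × M} (hz : z ∈ openSlab a b M)
    (k m i j : Fin 3) :
    coordFun k (fderiv ℝ (christoffelMap G z) (extChartAt IX z z) (basisVec m) (basisVec i)
      (basisVec j)) = partialD a b z m (christoffel G z k i j) (extChartAt IX z z) := by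
  have hnhds := coordSlab_mem_nhds hz (mem_extChartAt_source z)
  have hΓ := ((contDiffOn_christoffelMap G hab z).contDiffAt hnhds).differentiableAt one_ne_zero
  have h := (coordFun k).hasFDerivAt.comp _ ((hΓ.hasFDerivAt.clm_apply
    (hasFDerivAt_const (basisVec i) _)).clm_apply (hasFDerivAt_const (basisVec j) _))
  have heq : christoffel G z k i j =
      coordFun k ∘ fun y => christoffelMap G z y (basisVec i) (basisVec j) := funext fun y => by
    rw [Function.comp_apply, christoffelMap_basisVec, coordFun_sum_smul_basisVec]
  rw [partialD, fderivWithin_of_mem_nhds hnhds, heq, h.fderiv]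
  simp

theorem ricciCoord_eq_sum (hab : a < b) {z : ℝ × M} (hz : z ∈ openSlab a b M) (i j : Fin 3) :
    let Γ := christoffelMap G z (extChartAt IX z z)
    let Γ' := fderiv ℝ (christoffelMap G z) (extChartAt IX z z)
    ricciCoord G z i j = ∑ k, coordFun k (Γ' (basisVec k) (basisVec i) (basisVec j)
      - Γ' (basisVec j) (basisVec k) (basisVec i) + Γ (basisVec k) (Γ (basisVec i) (basisVec j))
      - Γ (basisVec j) (Γ (basisVec k) (basisVec i))) := by
  have hsymm : ∀ k, EqOn (christoffel G z k i k) (christoffel G z k k i) (coordSlab a b z) :=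
    fun k y hy => christoffel_symm G hy k i k
  have hy := extChartAt_mem_coordSlab (openSlab_subset_slab hz) (mem_extChartAt_source z)
  refine Finset.sum_congr rfl fun k _ => ?_
  simp only [map_sub, map_add, coordFun_fderiv_christoffelMap G hab hz]
  rw [partialD, partialD, partialD, fderivWithin_congr' (hsymm k) hy, add_sub_assoc,
    Finset.sum_sub_distrib]
  generalize extChartAt IX z z = y at hy ⊢
  simp [coordFun_christoffelMap, coordFun_basisVec, christoffel_symm G hy _ i k]

theorem ricci_self_eq_trace (hab : a < b) {z : ℝ × M} (hz : z ∈ openSlab a b M)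
    (u : TangentSpace IX z) : ricci G z u u = LinearMap.trace ℝ EX
      (jacobiOp (christoffelMap G z) (extChartAt IX z z) u) := by
  let Γ := christoffelMap G z (extChartAt IX z z)
  let Γ' := fderiv ℝ (christoffelMap G z) (extChartAt IX z z)
  let R : Fin 3 → EX →L[ℝ] EX →L[ℝ] EX := fun k => Γ' (basisVec k) - (Γ'.flip (basisVec k)).flip
    + ContinuousLinearMap.compL ℝ EX EX EX (Γ (basisVec k)) ∘L Γ - Γ.flip ∘L Γ (basisVec k)
  have hR : ∀ i j, ricciCoord G z i j = ∑ k, coordFun k (R k (basisVec i) (basisVec j)) :=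
    fun i j => ricciCoord_eq_sum G hab hz i j
  calc ricci G z u u
      = ∑ i, ∑ j, ∑ k, coordFun i u * coordFun j u * coordFun k (R k (basisVec i) (basisVec j)) :=
        Finset.sum_congr rfl fun i _ => Finset.sum_congr rfl fun j _ => by
          rw [hR, ← Finset.mul_sum, mul_assoc, mul_comm]; rfl
    _ = ∑ k, ∑ i, ∑ j, coordFun i u * coordFun j u * coordFun k (R k (basisVec i) (basisVec j)) :=
        (Finset.sum_congr rfl fun i _ => Finset.sum_comm).trans Finset.sum_comm
    _ = ∑ k, coordFun k (R k u u) := by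
        simp only [bilin_eq_sum_coordFun (R _) u u, map_sum, map_smul, smul_eq_mul]
    _ = LinearMap.trace ℝ EX (jacobiOp (christoffelMap G z) (extChartAt IX z z) u) := by
        rw [trace_eq_sum_coordFun]
        rfl

end Connection

section CovariantRules

variable {E : Type*} [NormedAddCommGroup E] [NormedSpace ℝ E]

theorem covariantFDeriv_smul (Γ : E → E →L[ℝ] E →L[ℝ] E) {f : E → ℝ} {U : E → E} {s : Set E}
    {x : E} (hs : UniqueDiffWithinAt ℝ s x) (hf : DifferentiableWithinAt ℝ f s x)
    (hU : DifferentiableWithinAt ℝ U s x) :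
    covariantFDeriv Γ s (fun y => f y • U y) x =
      f x • covariantFDeriv Γ s U x + (fderivWithin ℝ f s x).smulRight (U x) := by
  rw [covariantFDeriv, fderivWithin_fun_smul hs hf hU, map_smul, covariantFDeriv, smul_add]
  abel

theorem covariantFDeriv_sub (Γ : E → E →L[ℝ] E →L[ℝ] E) {U V : E → E} {s : Set E}
    {x : E} (hs : UniqueDiffWithinAt ℝ s x) (hU : DifferentiableWithinAt ℝ U s x)
    (hV : DifferentiableWithinAt ℝ V s x) :
    covariantFDeriv Γ s (fun y => U y - V y) x =
      covariantFDeriv Γ s U x - covariantFDeriv Γ s V x := by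
  rw [covariantFDeriv, fderivWithin_fun_sub hs hU hV, map_sub, covariantFDeriv, covariantFDeriv]
  abel

end CovariantRules

section ProductRules

variable {M : Type*} [TopologicalSpace M] [ChartedSpace (EuclideanSpace ℝ (Fin 2)) M] {a b : ℝ}

theorem scalarD_eq_sum (u : VField M) (f : ScalarField M) (z : ℝ × M) :
    scalarD a b u f z = ∑ i, comp z i (u z) * scalarD a b (fun x => pd x i) f z :=
  map_eq_sum_coordFun (mfderivWithin IX 𝓘(ℝ, ℝ) f (slab a b M) z : EX →L[ℝ] ℝ) (u z)

theorem uniqueMDiffWithinAt_slab (hab : a < b) {z : ℝ × M} (hz : z ∈ slab a b M) :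
    UniqueMDiffWithinAt IX (slab a b M) z :=
  ((uniqueDiffOn_Icc hab).uniqueMDiffOn.prod uniqueMDiffOn_univ) z hz

theorem scalarD_add (hab : a < b) (u : VField M) {f g : ScalarField M} {z : ℝ × M}
    (hz : z ∈ slab a b M) (hf : MDifferentiableWithinAt IX 𝓘(ℝ, ℝ) f (slab a b M) z)
    (hg : MDifferentiableWithinAt IX 𝓘(ℝ, ℝ) g (slab a b M) z) :
    scalarD a b u (fun x => f x + g x) z = scalarD a b u f z + scalarD a b u g z := by
  have h := (hf.hasMFDerivWithinAt.add hg.hasMFDerivWithinAt).mfderivWithin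
    (uniqueMDiffWithinAt_slab hab hz)
  exact DFunLike.congr_fun h (u z)

theorem scalarD_mul (hab : a < b) (u : VField M) {f g : ScalarField M} {z : ℝ × M}
    (hz : z ∈ slab a b M) (hf : MDifferentiableWithinAt IX 𝓘(ℝ, ℝ) f (slab a b M) z)
    (hg : MDifferentiableWithinAt IX 𝓘(ℝ, ℝ) g (slab a b M) z) :
    scalarD a b u (fun x => f x * g x) z = f z * scalarD a b u g z + g z * scalarD a b u f z := by
  have h := (hf.hasMFDerivWithinAt.mul hg.hasMFDerivWithinAt).mfderivWithin
    (uniqueMDiffWithinAt_slab hab hz)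
  exact DFunLike.congr_fun h (u z)

theorem scalarD_comp (hab : a < b) (u : VField M) {f : ScalarField M} {φ : ℝ → ℝ} {φ' : ℝ}
    {z : ℝ × M} (hz : z ∈ slab a b M) (hφ : HasDerivAt φ φ' (f z))
    (hf : MDifferentiableWithinAt IX 𝓘(ℝ, ℝ) f (slab a b M) z) :
    scalarD a b u (fun x => φ (f x)) z = φ' * scalarD a b u f z := by
  have h := (hφ.hasFDerivAt.hasMFDerivAt.comp_hasMFDerivWithinAt z
    hf.hasMFDerivWithinAt).mfderivWithin (uniqueMDiffWithinAt_slab hab hz)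
  exact (DFunLike.congr_fun h (u z)).trans (mul_comm (scalarD a b u f z) φ')

theorem scalarD_const_mul (hab : a < b) (u : VField M) (c : ℝ) {f : ScalarField M} {z : ℝ × M}
    (hz : z ∈ slab a b M) (hf : MDifferentiableWithinAt IX 𝓘(ℝ, ℝ) f (slab a b M) z) :
    scalarD a b u (fun x => c * f x) z = c * scalarD a b u f z :=
  scalarD_comp hab u (φ := (c * ·)) hz (by simpa using (hasDerivAt_id (f z)).const_mul c) hf

variable [IsManifold (𝓡 2) ∞ M] (G : SlabMetric a b M)

theorem dvg_smul (hab : a < b) {f : ScalarField M} {u : VField M} {z : ℝ × M}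
    (hz : z ∈ slab a b M) (hf : MDifferentiableWithinAt IX 𝓘(ℝ, ℝ) f (slab a b M) z)
    (hu : MDifferentiableWithinAt IX IX.tangent u.toBundle (slab a b M) z) :
    dvg G (fun x => f x • u x) z = f z * dvg G u z + scalarD a b u f z := by
  have hzz := mem_extChartAt_source (I := IX) z
  have hfu : MDifferentiableWithinAt IX IX.tangent (VField.toBundle fun x => f x • u x)
      (slab a b M) z := hf.smul_section hu
  have hrep : covRep G (fun x => f x • u x) z (extChartAt IX z z) =
      f z • covRep G u z (extChartAt IX z z) + (fderivWithin ℝ (scalarRep f z) (coordSlab a b z)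
        (extChartAt IX z z)).smulRight (vecRep u z (extChartAt IX z z)) := by
    rw [covRep, vecRep_smul, covariantFDeriv_smul (f := scalarRep f z) _
      (uniqueDiffWithinAt_coordSlab hab hz hzz)
      (differentiableWithinAt_comp_extChartAt_symm (F := ℝ) (f := f) hf hzz)
      (differentiableWithinAt_vecRep hu hzz), scalarRep_extChartAt f hzz, covRep]
  rw [dvg_eq_trace G hab hz hzz hfu, dvg_eq_trace G hab hz hzz hu, hrep,
    scalarD_eq_fderivWithin_self u hf, ContinuousLinearMap.toLinearMap_add, map_add, vecRep_self]
  congr 1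
  · exact map_smul (LinearMap.trace ℝ EX) _ _
  · exact LinearMap.trace_smulRight _ _

theorem dvg_sub (hab : a < b) {u v : VField M} {z : ℝ × M} (hz : z ∈ slab a b M)
    (hu : MDifferentiableWithinAt IX IX.tangent u.toBundle (slab a b M) z)
    (hv : MDifferentiableWithinAt IX IX.tangent v.toBundle (slab a b M) z) :
    dvg G (fun x => u x - v x) z = dvg G u z - dvg G v z := by
  have hzz := mem_extChartAt_source (I := IX) z
  have huv : MDifferentiableWithinAt IX IX.tangent (VField.toBundle fun x => u x - v x)
      (slab a b M) z := mdifferentiableWithinAt_sub_section hu hv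
  rw [dvg_eq_trace G hab hz hzz hu, dvg_eq_trace G hab hz hzz hv,
    dvg_eq_trace G hab hz hzz huv, covRep, vecRep_sub,
    covariantFDeriv_sub _ (uniqueDiffWithinAt_coordSlab hab hz hzz)
      (differentiableWithinAt_vecRep hu hzz) (differentiableWithinAt_vecRep hv hzz),
    ContinuousLinearMap.toLinearMap_sub, map_sub, covRep, covRep]

theorem mdifferentiableWithinAt_inner_section {u v : VField M} {z : ℝ × M}
    (hz : z ∈ slab a b M)
    (hu : MDifferentiableWithinAt IX IX.tangent u.toBundle (slab a b M) z)
    (hv : MDifferentiableWithinAt IX IX.tangent v.toBundle (slab a b M) z) :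
    MDifferentiableWithinAt IX 𝓘(ℝ, ℝ) (fun x => G.inner x (u x) (v x)) (slab a b M) z := by
  have h : MDifferentiableWithinAt IX (IX.prod 𝓘(ℝ))
      (fun m => TotalSpace.mk' ℝ (E := Bundle.Trivial (ℝ × M) ℝ) m (G.inner m (u m) (v m)))
      (slab a b M) z :=
    MDifferentiableWithinAt.clm_bundle_apply₂ (F₁ := EX) (F₂ := EX)
      ((G.smooth z hz).mdifferentiableWithinAt (by simp)) hu hv
  exact ((mdifferentiableWithinAt_totalSpace IX _).1 h).2

theorem tensorDvg_tmul (hab : a < b) {v w : VField M} {z : ℝ × M} (hz : z ∈ slab a b M)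
    (hv : MDifferentiableWithinAt IX IX.tangent v.toBundle (slab a b M) z)
    (hw : MDifferentiableWithinAt IX IX.tangent w.toBundle (slab a b M) z) :
    tensorDvg G (fun x => v x ⊗ₜ[ℝ] w x) z = covDeriv G w v z + dvg G w z • v z := by
  have hzz := mem_extChartAt_source (I := IX) z
  have hdiff : ∀ {u : VField M} (i : Fin 3),
      MDifferentiableWithinAt IX IX.tangent u.toBundle (slab a b M) z →
      DifferentiableWithinAt ℝ (vecCoord u z i) (coordSlab a b z) (extChartAt IX z z) :=
    fun i hu => (coordFun i).differentiableAt.comp_differentiableWithinAt _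
      (differentiableWithinAt_vecRep hu hzz)
  have hleibniz : ∀ i j, partialD a b z j (tensorCoord (fun x => v x ⊗ₜ[ℝ] w x) z i j)
      (extChartAt IX z z) = vecCoord v z i (extChartAt IX z z) *
        partialD a b z j (vecCoord w z j) (extChartAt IX z z) +
      vecCoord w z j (extChartAt IX z z) *
        partialD a b z j (vecCoord v z i) (extChartAt IX z z) := fun i j =>
    DFunLike.congr_fun (fderivWithin_fun_mul (uniqueDiffWithinAt_coordSlab hab hz hzz)
      (hdiff i hv) (hdiff j hw)) (basisVec j)
  have hself : ∀ (u : VField M) i, vecCoord u z i (extChartAt IX z z) = comp z i (u z) :=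
    fun u i => congrArg (coordFun i) (vecRep_self u z)
  have htmul : ∀ i j, tensorCoord (fun x => v x ⊗ₜ[ℝ] w x) z i j (extChartAt IX z z) =
      comp z i (v z) * comp z j (w z) := fun i j => congrArg₂ (· * ·) (hself v i) (hself w j)
  refine ext_coordFun fun i => (coordFun_sum_smul_basisVec _ i).trans ?_
  have hcov : coordFun i (covDeriv G w v z) = ∑ j, covDiff G v z i j * comp z j (w z) :=
    coordFun_sum_smul_basisVec _ i
  refine Eq.trans ?_ (map_add (comp z i) _ _).symm
  rw [map_smul]
  refine Eq.trans ?_ (congrArg (· + _) hcov.symm)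
  simp only [hleibniz, htmul, hself, dvg, covDiff, smul_eq_mul, Fin.sum_univ_three]
  ring

theorem scalarD_inner (hab : a < b) (w : VField M) {u v : VField M} {z : ℝ × M}
    (hz : z ∈ slab a b M)
    (hu : MDifferentiableWithinAt IX IX.tangent u.toBundle (slab a b M) z)
    (hv : MDifferentiableWithinAt IX IX.tangent v.toBundle (slab a b M) z) :
    scalarD a b w (fun x => G.inner x (u x) (v x)) z =
      G.inner z (covDeriv G w u z) (v z) + G.inner z (u z) (covDeriv G w v z) := by
  have hzz := mem_extChartAt_source (I := IX) z
  have hy := extChartAt_mem_coordSlab hz hzz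
  have hrep : EqOn (scalarRep (fun x => G.inner x (u x) (v x)) z)
      (fun y => metricForm G z y (vecRep u z y) (vecRep v z y)) (coordSlab a b z) := by
    intro y hy
    have h := metricForm_vecRep G u v z ((extChartAt IX z).map_target hy.1)
    rw [(extChartAt IX z).right_inv hy.1] at h
    exact h.symm
  have hderiv := ((differentiableWithinAt_metricForm (G := G) hy).hasFDerivWithinAt.clm_apply
    (differentiableWithinAt_vecRep hu hzz).hasFDerivWithinAt).clm_apply
    (differentiableWithinAt_vecRep hv hzz).hasFDerivWithinAt
  have hcompat : ∀ e : EX, fderivWithin ℝ (scalarRep (fun x => G.inner x (u x) (v x)) z)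
      (coordSlab a b z) (extChartAt IX z z) e =
        metricForm G z (extChartAt IX z z) (covRep G u z (extChartAt IX z z) e)
          (vecRep v z (extChartAt IX z z)) +
        metricForm G z (extChartAt IX z z) (vecRep u z (extChartAt IX z z))
          (covRep G v z (extChartAt IX z z) e) := by
    intro e
    rw [fderivWithin_congr' hrep hy,
      hderiv.fderivWithin (uniqueDiffWithinAt_coordSlab hab hz hzz)]
    simp only [covRep, covariantFDeriv_apply, map_add, add_apply, ContinuousLinearMap.coe_comp,
      Function.comp_apply, ContinuousLinearMap.flip_apply, fderivWithin_metricForm_eq G hab hy]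
    ring
  rw [scalarD_eq_fderivWithin_self w (mdifferentiableWithinAt_inner_section G hz hu hv),
    ← metricForm_self, ← metricForm_self, covDeriv_eq_covRep G hab w hz hu,
    covDeriv_eq_covRep G hab w hz hv]
  simpa only [vecRep_self] using hcompat (w z)

end ProductRules

section Gradient

variable {M : Type*} [TopologicalSpace M] [ChartedSpace (EuclideanSpace ℝ (Fin 2)) M]
  [IsManifold (𝓡 2) ∞ M] {a b : ℝ} (G : SlabMetric a b M)

theorem inner_grad (f : ScalarField M) (v : VField M) {z : ℝ × M} (hz : z ∈ slab a b M) :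
    G.inner z (grad G f z) (v z) = scalarD a b v f z := by
  have hy := extChartAt_mem_coordSlab hz (mem_extChartAt_source z)
  have hbasis : ∀ l, G.inner z (grad G f z) (pd z l) = scalarD a b (fun x => pd x l) f z :=
    fun l => (metricForm_self G z _ _).symm.trans
      (metricForm_sum_inv hy (fun j => scalarD a b (fun x => pd x j) f z) l)
  rw [scalarD_eq_sum]
  refine (map_eq_sum_coordFun (G.inner z (grad G f z) : EX →L[ℝ] ℝ) (v z)).trans
    (Finset.sum_congr rfl fun l _ => ?_)
  exact congrArg (coordFun l (v z) * ·) (hbasis l)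

theorem metricForm_vecRep_grad (hab : a < b) {f : ScalarField M} {z x : ℝ × M}
    (hf : MDifferentiableWithinAt IX 𝓘(ℝ, ℝ) f (slab a b M) x) (hx : x ∈ slab a b M)
    (hxz : x ∈ (extChartAt IX z).source) (l : EX) :
    metricForm G z (extChartAt IX z x) (vecRep (grad G f) z (extChartAt IX z x)) l =
      fderivWithin ℝ (scalarRep f z) (coordSlab a b z) (extChartAt IX z x) l := by
  let w : VField M := fun x' => tangentCoordChange IX z x' x' l
  have hw : vecRep w z (extChartAt IX z x) = l :=
    (vecRep_extChartAt w hxz).trans (tangentCoordChange_inv (mem_extChartAt_source x) hxz l)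
  calc metricForm G z (extChartAt IX z x) (vecRep (grad G f) z (extChartAt IX z x)) l
      = G.inner x (grad G f x) (w x) := by rw [← metricForm_vecRep G (grad G f) w z hxz, hw]
    _ = fderivWithin ℝ (scalarRep f z) (coordSlab a b z) (extChartAt IX z x) l := by
      rw [inner_grad G f w hx, scalarD_eq_fderivWithin hab w hf hx hxz,
        ← vecRep_extChartAt w hxz, hw]

theorem vecRep_grad (hab : a < b) {f : ScalarField M} {z x : ℝ × M}
    (hf : MDifferentiableWithinAt IX 𝓘(ℝ, ℝ) f (slab a b M) x) (hx : x ∈ slab a b M)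
    (hxz : x ∈ (extChartAt IX z).source) :
    vecRep (grad G f) z (extChartAt IX z x) =
      ∑ i, (∑ j, (metricCoord G z (extChartAt IX z x))⁻¹ i j *
        partialD a b z j (scalarRep f z) (extChartAt IX z x)) • basisVec i := by
  have hy := extChartAt_mem_coordSlab hx hxz
  refine metricForm_ext (G := G) hy fun l => ?_
  rw [metricForm_vecRep_grad G hab hf hx hxz, map_eq_sum_coordFun]
  refine ((map_eq_sum_coordFun _ l).trans (Finset.sum_congr rfl fun k _ => ?_)).symm
  rw [metricForm_sum_inv (G := G) hy]
  rfl

end Gradient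

section Regularity

variable {M : Type*} [TopologicalSpace M] [ChartedSpace (EuclideanSpace ℝ (Fin 2)) M]
  [IsManifold (𝓡 2) ∞ M] {a b : ℝ} (G : SlabMetric a b M) {s : Set (ℝ × M)} {m n : ℕ∞ω}

theorem contMDiffOn_of_contDiffOn_vecRep {u : VField M}
    (hu : ∀ z ∈ s, ContDiffOn ℝ n (vecRep u z)
      ((extChartAt IX z).target ∩ (extChartAt IX z).symm ⁻¹' s)) :
    ContMDiffOn IX IX.tangent n u.toBundle s := by
  intro z hz
  refine contMDiffWithinAt_section.2 (contMDiffWithinAt_of_eqOn_chart hz (hu z hz _ ?_)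
    fun x _ hxz => (vecRep_extChartAt u hxz).symm)
  exact ⟨mem_extChartAt_target z, by rwa [mem_preimage, extChartAt_to_inv]⟩

theorem contDiffOn_fderivWithin_scalarRep {f : ScalarField M} (hs : s ⊆ slab a b M)
    (hsu : UniqueMDiffOn IX s) (hn : n ≤ ∞) (hmn : m + 1 ≤ n)
    (hf : MDifferentiableOn IX 𝓘(ℝ, ℝ) f (slab a b M))
    (hfs : ContMDiffOn IX 𝓘(ℝ, ℝ) n f s) (z : ℝ × M) :
    ContDiffOn ℝ m (fderivWithin ℝ (scalarRep f z) (coordSlab a b z))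
      ((extChartAt IX z).target ∩ (extChartAt IX z).symm ⁻¹' s) := by
  have hunique := hsu.uniqueDiffOn_target_inter z
  refine ((contDiffOn_comp_extChartAt_symm hn hfs z).fderivWithin hunique hmn).congr
    fun y hy => (fderivWithin_subset (inter_subset_inter_right _ (preimage_mono hs))
      (hunique y hy) ?_).symm
  have h := differentiableWithinAt_comp_extChartAt_symm (F := ℝ) (f := f) (hf _ (hs hy.2))
    ((extChartAt IX z).map_target hy.1)
  rwa [(extChartAt IX z).right_inv hy.1] at h

theorem contMDiffOn_scalarD (hab : a < b) {f : ScalarField M} {u : VField M}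
    (hs : s ⊆ slab a b M) (hsu : UniqueMDiffOn IX s) (hn : n ≤ ∞) (hmn : m + 1 ≤ n)
    [ContMDiffVectorBundle m EX (TangentSpace IX : ℝ × M → Type _) IX]
    (hf : MDifferentiableOn IX 𝓘(ℝ, ℝ) f (slab a b M))
    (hfs : ContMDiffOn IX 𝓘(ℝ, ℝ) n f s) (hu : ContMDiffOn IX IX.tangent m u.toBundle s) :
    ContMDiffOn IX 𝓘(ℝ, ℝ) m (scalarD a b u f) s := by
  intro z hz
  have hm : m ≤ ∞ := (self_le_add_right m 1).trans (hmn.trans hn)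
  refine contMDiffWithinAt_of_eqOn_chart (H := fun y =>
    fderivWithin ℝ (scalarRep f z) (coordSlab a b z) y (vecRep u z y)) hz
    (((contDiffOn_fderivWithin_scalarRep hs hsu hn hmn hf hfs z).clm_apply
      (contDiffOn_vecRep hm hu z)) _ ?_) fun x hx hxz => ?_
  · exact ⟨mem_extChartAt_target z, by rwa [mem_preimage, extChartAt_to_inv]⟩
  · rw [scalarD_eq_fderivWithin hab u (hf x (hs hx)) (hs hx) hxz, vecRep_extChartAt u hxz]

theorem contMDiffOn_grad (hab : a < b) {f : ScalarField M}
    (hs : s ⊆ slab a b M) (hsu : UniqueMDiffOn IX s) (hn : n ≤ ∞) (hmn : m + 1 ≤ n)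
    (hf : MDifferentiableOn IX 𝓘(ℝ, ℝ) f (slab a b M))
    (hfs : ContMDiffOn IX 𝓘(ℝ, ℝ) n f s) :
    ContMDiffOn IX IX.tangent m (grad G f).toBundle s := by
  have hm : m ≤ ∞ := (self_le_add_right m 1).trans (hmn.trans hn)
  refine contMDiffOn_of_contDiffOn_vecRep fun z _ => ContDiffOn.congr (f := fun y =>
    ∑ i, (∑ j, (metricCoord G z y)⁻¹ i j * partialD a b z j (scalarRep f z) y) • basisVec i)
    ?_ fun y hy => ?_
  · refine ContDiffOn.sum fun i _ => (ContDiffOn.sum fun j _ => ?_).fun_smul contDiffOn_const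
    refine (((contDiffOn_metricCoord_inv G z i j).of_le hm).mono
      (inter_subset_inter_right _ (preimage_mono hs))).mul ?_
    exact (contDiffOn_fderivWithin_scalarRep hs hsu hn hmn hf hfs z).clm_apply contDiffOn_const
  · have h := vecRep_grad G hab (hf _ (hs hy.2)) (hs hy.2) ((extChartAt IX z).map_target hy.1)
    rwa [(extChartAt IX z).right_inv hy.1] at h

theorem continuousOn_dvg (hab : a < b) {u : VField M}
    (hu : ContMDiffOn IX IX.tangent 1 u.toBundle (slab a b M)) :
    ContinuousOn (dvg G u) (slab a b M) := by
  intro z hz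
  have htrace : Continuous (LinearMap.trace ℝ EX ∘ₗ
      ContinuousLinearMap.coeLM ℝ (M := EX) (N₃ := EX)) :=
    LinearMap.continuous_of_finiteDimensional _
  have hcov : ContDiffOn ℝ 0 (fun y => LinearMap.trace ℝ EX (covRep G u z y))
      (coordSlab a b z) :=
    contDiffOn_zero.2 (htrace.comp_continuousOn (continuousOn_covRep G hab hu z))
  refine (contMDiffWithinAt_of_eqOn_chart hz (hcov _ (extChartAt_mem_coordSlab hz
    (mem_extChartAt_source z))) fun x hx hxz => ?_).continuousWithinAt
  exact dvg_eq_trace G hab hx hxz (hu.mdifferentiableOn one_ne_zero x hx)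

theorem continuousOn_covDeriv (hab : a < b) {u w : VField M}
    (hu : ContMDiffOn IX IX.tangent 1 u.toBundle (slab a b M))
    (hw : ContinuousOn w.toBundle (slab a b M)) :
    ContinuousOn (covDeriv G w u).toBundle (slab a b M) := by
  refine (contMDiffOn_of_contDiffOn_vecRep (n := 0) fun z _ => contDiffOn_zero.2 <|
    ((continuousOn_covRep G hab hu z).clm_apply (contDiffOn_zero.1 <|
      contDiffOn_vecRep (by simp) (contMDiffOn_zero_iff.2 hw) z)).congr fun y hy => ?_).continuousOn
  have h := vecRep_covDeriv G hab w hy.2 ((extChartAt IX z).map_target hy.1)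
    (hu.mdifferentiableOn one_ne_zero _ hy.2)
  rwa [(extChartAt IX z).right_inv hy.1] at h

end Regularity

section Streamlines

variable {M : Type*} [TopologicalSpace M] [ChartedSpace (EuclideanSpace ℝ (Fin 2)) M]
  {a b : ℝ} {u : VField M} {X : ℝ → ℝ × M} {t : ℝ}

theorem hasDerivAt_comp_integralCurve {f : ScalarField M} (hX : IsMIntegralCurveAt X u t)
    (hXt : X t ∈ openSlab a b M) (hf : MDifferentiableAt IX 𝓘(ℝ, ℝ) f (X t)) :
    HasDerivAt (fun t => f (X t)) (scalarD a b u f (X t)) t := by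
  let L : EX →L[ℝ] ℝ := mfderiv IX 𝓘(ℝ, ℝ) f (X t)
  let v : EX := u (X t)
  have h : HasFDerivAt (fun t => f (X t)) (L ∘L (1 : ℝ →L[ℝ] ℝ).smulRight v) t :=
    (hf.hasMFDerivAt.comp t hX.hasMFDerivAt).hasFDerivAt
  rw [scalarD, mfderivWithin_of_mem_nhds (slab_mem_nhds hXt)]
  exact h.hasDerivAt.congr_deriv (congrArg L (one_smul ℝ v))

variable [IsManifold (𝓡 2) ∞ M]

theorem eventually_hasDerivAt_extChartAt_integralCurve (hX : IsMIntegralCurveAt X u t) :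
    ∀ᶠ t' in 𝓝 t, HasDerivAt (fun t' => extChartAt IX (X t) (X t'))
      (vecRep u (X t) (extChartAt IX (X t) (X t'))) t' := by
  filter_upwards [hX.eventually_hasDerivAt,
    hX.continuousAt.eventually (extChartAt_source_mem_nhds (I := IX) (X t))] with t' ht' hXt'
  rwa [vecRep_extChartAt u hXt']

variable (G : SlabMetric a b M)

theorem eventually_covRep_eq {z : ℝ × M} (hz : z ∈ openSlab a b M) (w : VField M) :
    ∀ᶠ y in 𝓝 (extChartAt IX z z),
      covRep G w z y = covariantFDeriv (christoffelMap G z) univ (vecRep w z) y := by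
  filter_upwards [eventually_mem_nhds_iff.2 (coordSlab_mem_nhds hz (mem_extChartAt_source z))]
    with y hy
  simp only [covRep, covariantFDeriv, fderivWithin_univ, fderivWithin_of_mem_nhds hy]

theorem eventually_vecRep_covDeriv (hab : a < b) {w A : VField M}
    (hu : MDifferentiableOn IX IX.tangent u.toBundle (slab a b M))
    (hA : ∀ x ∈ openSlab a b M, A x = covDeriv G w u x) {z : ℝ × M} (hz : z ∈ openSlab a b M) :
    ∀ᶠ y in 𝓝 (extChartAt IX z z), vecRep A z y =
      covariantFDeriv (christoffelMap G z) univ (vecRep u z) y (vecRep w z y) := by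
  filter_upwards [target_inter_openSlab_mem_nhds hz, eventually_covRep_eq G hz u]
    with y hy hcov
  have h := vecRep_covDeriv G hab w (openSlab_subset_slab hy.2)
    ((extChartAt IX z).map_target hy.1) (hu _ (openSlab_subset_slab hy.2))
  rw [(extChartAt IX z).right_inv hy.1] at h
  rw [← hcov, ← h, vecRep, hA _ hy.2]
  rfl

/-- This is `D_u (div u) = div (D_u u) - C(Du ⊗ Du) - Ric(u, u)`, stated along the streamlines
because `div u` itself is only continuous. -/
theorem hasDerivAt_dvg_integralCurve (hab : a < b) {A : VField M}
    (hu : ContMDiffOn IX IX.tangent 1 u.toBundle (slab a b M))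
    (hA : ContMDiffOn IX IX.tangent 1 A.toBundle (openSlab a b M))
    (hAu : ∀ x ∈ openSlab a b M, A x = covDeriv G u u x)
    (hX : IsMIntegralCurveAt X u 0) (hX0 : X 0 ∈ openSlab a b M) :
    HasDerivAt (fun t => dvg G u (X t))
      (dvg G A (X 0) - contractDD G u (X 0) - ricci G (X 0) (u (X 0)) (u (X 0))) 0 := by
  have hsource := mem_extChartAt_source (I := IX) (X 0)
  have hX0' := openSlab_subset_slab hX0
  have hslab : coordSlab a b (X 0) ∈ 𝓝 (extChartAt IX (X 0) (X 0)) :=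
    coordSlab_mem_nhds hX0 hsource
  have hud := hu.mdifferentiableOn one_ne_zero
  have hAd : MDifferentiableWithinAt IX IX.tangent A.toBundle (slab a b M) (X 0) :=
    ((hA.mdifferentiableOn one_ne_zero _ hX0).mdifferentiableAt
      (isOpen_openSlab.mem_nhds hX0)).mdifferentiableWithinAt
  have hξ := eventually_hasDerivAt_extChartAt_integralCurve hX
  have hderiv := hasDerivAt_trace_covariantFDeriv_integralCurve
    ((contDiffOn_christoffelMap G hab (X 0)).contDiffAt hslab)
    (christoffelMap_symm (mem_of_mem_nhds hslab))
    ((contDiffOn_vecRep (by norm_cast) hu (X 0)).contDiffAt hslab)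
    ((contDiffOn_vecRep (by norm_cast) hA (X 0)).contDiffAt
      (target_inter_openSlab_mem_nhds hX0))
    (eventually_vecRep_covDeriv G hab hud hAu hX0) hξ
  refine (hderiv.congr_of_eventuallyEq ?_).congr_deriv ?_
  · filter_upwards [hX.continuousAt.eventually (isOpen_openSlab.mem_nhds hX0),
      hX.continuousAt.eventually (extChartAt_source_mem_nhds (I := IX) (X 0)),
      hξ.self_of_nhds.continuousAt.eventually (eventually_covRep_eq G hX0 u)] with t ht hts hcov
    rw [← hcov, dvg_eq_trace G hab (openSlab_subset_slab ht) hts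
      (hud _ (openSlab_subset_slab ht))]
  · rw [dvg_eq_trace G hab hX0' hsource hAd, contractDD_eq_trace G hab hX0' (hud _ hX0'),
      ricci_self_eq_trace G hab hX0, (eventually_covRep_eq G hX0 u).self_of_nhds,
      (eventually_covRep_eq G hX0 A).self_of_nhds, vecRep_self]

end Streamlines

section Residuals

theorem entropyA_eq {M : Type*} {γ k₀ cν : ℝ} {p ρ s : ScalarField M} {z : ℝ × M}
    (hρ : 0 < ρ z) (hstate : p z = entropyA k₀ cν s z * ρ z ^ γ) :
    entropyA k₀ cν s z = p z * ρ z ^ (-γ) := by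
  rw [hstate, mul_assoc, ← Real.rpow_add hρ, add_neg_cancel, Real.rpow_zero, mul_one]

variable {M : Type*} [TopologicalSpace M] [ChartedSpace (EuclideanSpace ℝ (Fin 2)) M]
  {a b γ k₀ cν : ℝ} {r p ρ s : ScalarField M} {f u : VField M} {z : ℝ × M}

theorem rpow_mul_scalarD_entropyA (hab : a < b) (hz : z ∈ slab a b M)
    (hp : MDifferentiableWithinAt IX 𝓘(ℝ, ℝ) p (slab a b M) z)
    (hρ : MDifferentiableWithinAt IX 𝓘(ℝ, ℝ) ρ (slab a b M) z)
    (hρpos : ∀ x ∈ slab a b M, 0 < ρ x)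
    (hstate : ∀ x ∈ slab a b M, p x = entropyA k₀ cν s x * ρ x ^ γ) :
    ρ z ^ (γ - 1) * scalarD a b u (entropyA k₀ cν s) z =
      scalarD a b u p z / ρ z - γ * p z * scalarD a b u ρ z / ρ z ^ 2 := by
  have hρz := hρpos z hz
  have hA : ∀ x ∈ slab a b M, entropyA k₀ cν s x = p x * ρ x ^ (-γ) := fun x hx =>
    entropyA_eq (hρpos x hx) (hstate x hx)
  have hrpow := Real.hasDerivAt_rpow_const (x := ρ z) (p := -γ) (Or.inl hρz.ne')
  have hD : scalarD a b u (entropyA k₀ cν s) z =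
      p z * (-γ * ρ z ^ (-γ - 1) * scalarD a b u ρ z) + ρ z ^ (-γ) * scalarD a b u p z := by
    rw [← scalarD_comp hab u hz hrpow hρ, ← scalarD_mul hab u (g := fun x => ρ x ^ (-γ)) hz hp
      (hrpow.differentiableAt.mdifferentiableAt.comp_mdifferentiableWithinAt z hρ)]
    exact congrArg (fun L : EX →L[ℝ] ℝ => L (u z)) (mfderivWithin_congr hA (hA z hz))
  have hone : ρ z ^ (γ - 1) * ρ z ^ (-γ) = (ρ z)⁻¹ := by
    rw [← Real.rpow_add hρz, ← Real.rpow_neg_one]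
    ring_nf
  have htwo : ρ z ^ (γ - 1) * ρ z ^ (-γ - 1) = (ρ z ^ 2)⁻¹ := by
    rw [← Real.rpow_add hρz, ← Real.rpow_natCast, ← Real.rpow_neg hρz.le]
    push_cast
    ring_nf
  rw [hD, div_eq_mul_inv, div_eq_mul_inv, ← hone, ← htwo]
  ring

variable [IsManifold (𝓡 2) ∞ M] (G : SlabMetric a b M)

theorem mdifferentiableWithinAt_bernoulli (hz : z ∈ slab a b M)
    (hp : MDifferentiableWithinAt IX 𝓘(ℝ, ℝ) p (slab a b M) z)
    (hρ : MDifferentiableWithinAt IX 𝓘(ℝ, ℝ) ρ (slab a b M) z) (hρz : ρ z ≠ 0)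
    (hu : MDifferentiableWithinAt IX IX.tangent u.toBundle (slab a b M) z) :
    MDifferentiableWithinAt IX 𝓘(ℝ, ℝ) (bernoulli G γ p ρ u) (slab a b M) z := by
  have hinner := mdifferentiableWithinAt_inner_section G hz hu hu
  have hsonic : MDifferentiableWithinAt IX 𝓘(ℝ, ℝ) (sonicSq γ p ρ) (slab a b M) z :=
    ((mdifferentiableWithinAt_const (c := γ)).mul hp).mul
      ((differentiableAt_inv hρz).mdifferentiableAt.comp_mdifferentiableWithinAt z hρ)
  exact ((mdifferentiableWithinAt_const (c := (1 / 2 : ℝ))).mul hinner).add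
    (hsonic.mul (mdifferentiableWithinAt_const (c := (γ - 1)⁻¹)))

theorem scalarD_bernoulli (hab : a < b) (hz : z ∈ slab a b M)
    (hp : MDifferentiableWithinAt IX 𝓘(ℝ, ℝ) p (slab a b M) z)
    (hρ : MDifferentiableWithinAt IX 𝓘(ℝ, ℝ) ρ (slab a b M) z) (hρz : ρ z ≠ 0)
    (hu : MDifferentiableWithinAt IX IX.tangent u.toBundle (slab a b M) z) :
    scalarD a b u (bernoulli G γ p ρ u) z = G.inner z (covDeriv G u u z) (u z) +
      γ / (γ - 1) * (scalarD a b u p z / ρ z - p z * scalarD a b u ρ z / ρ z ^ 2) := by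
  have hE : bernoulli G γ p ρ u = fun x =>
      1 / 2 * G.inner x (u x) (u x) + γ / (γ - 1) * (p x * (ρ x)⁻¹) := funext fun x => by
    rw [bernoulli, sonicSq]
    ring
  have hinner := mdifferentiableWithinAt_inner_section G hz hu hu
  have hinv : MDifferentiableWithinAt IX 𝓘(ℝ, ℝ) (fun x => (ρ x)⁻¹) (slab a b M) z :=
    (differentiableAt_inv hρz).mdifferentiableAt.comp_mdifferentiableWithinAt z hρ
  have hpρ : MDifferentiableWithinAt IX 𝓘(ℝ, ℝ) (fun x => p x * (ρ x)⁻¹) (slab a b M) z :=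
    hp.mul hinv
  rw [hE, scalarD_add hab u (f := fun x => 1 / 2 * G.inner x (u x) (u x))
    (g := fun x => γ / (γ - 1) * (p x * (ρ x)⁻¹)) hz (mdifferentiableWithinAt_const.mul hinner)
    (mdifferentiableWithinAt_const.mul hpρ), scalarD_const_mul hab u _ hz hinner,
    scalarD_const_mul hab u _ hz hpρ, scalarD_mul hab u hz hp hinv,
    scalarD_comp hab u hz (hasDerivAt_inv hρz) hρ, scalarD_inner G hab u hz hu hu,
    G.symm z hz (u z)]
  ring

theorem inner_resMomentum (hz : z ∈ slab a b M) :
    G.inner z (resMomentum G f p ρ u z) (u z) = G.inner z (covDeriv G u u z) (u z) +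
      scalarD a b u p z / ρ z - G.inner z (f z) (u z) := by
  rw [resMomentum, map_sub, map_add, map_smul, ← inner_grad G p u hz]
  simp only [sub_apply, add_apply, smul_apply, smul_eq_mul]
  ring

theorem resBernoulli_eq (hab : a < b) (hγ : 1 < γ) (hz : z ∈ slab a b M)
    (hp : MDifferentiableWithinAt IX 𝓘(ℝ, ℝ) p (slab a b M) z)
    (hρ : MDifferentiableWithinAt IX 𝓘(ℝ, ℝ) ρ (slab a b M) z)
    (hρpos : ∀ x ∈ slab a b M, 0 < ρ x)
    (hstate : ∀ x ∈ slab a b M, p x = entropyA k₀ cν s x * ρ x ^ γ)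
    (hu : MDifferentiableWithinAt IX IX.tangent u.toBundle (slab a b M) z) :
    resBernoulli G γ f r p ρ u z = G.inner z (resMomentum G f p ρ u z) (u z) +
      ρ z ^ (γ - 1) / (γ - 1) * resEntropy a b γ k₀ cν r ρ s u z := by
  have hρz := hρpos z hz
  have hγ' : γ - 1 ≠ 0 := (sub_pos.2 hγ).ne'
  have hρ' : ρ z ^ (γ - 1) ≠ 0 := (Real.rpow_pos_of_pos hρz _).ne'
  have hA : ρ z ^ (γ - 1) / (γ - 1) * resEntropy a b γ k₀ cν r ρ s u z =
      (scalarD a b u p z / ρ z - γ * p z * scalarD a b u ρ z / ρ z ^ 2 - (γ - 1) * r z)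
        / (γ - 1) := by
    rw [← rpow_mul_scalarD_entropyA hab hz hp hρ hρpos hstate, resEntropy]
    field_simp
  rw [hA, inner_resMomentum G hz, resBernoulli, scalarD_bernoulli G hab hz hp hρ hρz.ne' hu]
  field_simp
  ring

theorem resMass_eq (hab : a < b) (hγ : γ ≠ 0) (hz : z ∈ slab a b M)
    (hp : MDifferentiableWithinAt IX 𝓘(ℝ, ℝ) p (slab a b M) z) (hpz : p z ≠ 0)
    (hρ : MDifferentiableWithinAt IX 𝓘(ℝ, ℝ) ρ (slab a b M) z)
    (hρpos : ∀ x ∈ slab a b M, 0 < ρ x)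
    (hstate : ∀ x ∈ slab a b M, p x = entropyA k₀ cν s x * ρ x ^ γ)
    (hu : MDifferentiableWithinAt IX IX.tangent u.toBundle (slab a b M) z) :
    resMass G γ r p ρ u z = dvg G (fun x => ρ x • u x) z / ρ z +
      ρ z * ρ z ^ (γ - 1) / (γ * p z) * resEntropy a b γ k₀ cν r ρ s u z := by
  have hρz := hρpos z hz
  have hρ' : ρ z ^ (γ - 1) ≠ 0 := (Real.rpow_pos_of_pos hρz _).ne'
  have hA : ρ z * ρ z ^ (γ - 1) / (γ * p z) * resEntropy a b γ k₀ cν r ρ s u z =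
      ρ z / (γ * p z) * (scalarD a b u p z / ρ z - γ * p z * scalarD a b u ρ z / ρ z ^ 2
        - (γ - 1) * r z) := by
    rw [← rpow_mul_scalarD_entropyA hab hz hp hρ hρpos hstate, resEntropy]
    field_simp
  rw [hA, dvg_smul G hab hz hρ hu, resMass, sonicSq]
  field_simp
  ring

theorem covDeriv_smul_left (g : ScalarField M) (w v : VField M) (z : ℝ × M) :
    covDeriv G (fun x => g x • w x) v z = g z • covDeriv G w v z := by
  simp only [covDeriv, map_smul, smul_eq_mul, Finset.smul_sum, smul_smul, Finset.mul_sum]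
  refine Finset.sum_congr rfl fun i _ => congrArg (· • pd z i) (Finset.sum_congr rfl fun j _ => ?_)
  ring

theorem momentum_flux_eq (hab : a < b) (hz : z ∈ slab a b M)
    (hρ : MDifferentiableWithinAt IX 𝓘(ℝ, ℝ) ρ (slab a b M) z) (hρz : ρ z ≠ 0)
    (hu : MDifferentiableWithinAt IX IX.tangent u.toBundle (slab a b M) z) :
    tensorDvg G (fun x => ρ x • (u x ⊗ₜ[ℝ] u x)) z + grad G p z - ρ z • f z =
      ρ z • resMomentum G f p ρ u z + dvg G (fun x => ρ x • u x) z • u z := by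
  simp only [← TensorProduct.tmul_smul]
  rw [tensorDvg_tmul G hab (w := fun x => ρ x • u x) hz hu (hρ.smul_section hu),
    covDeriv_smul_left, resMomentum, smul_sub, smul_add, smul_inv_smul₀ hρz]
  abel

theorem energy_flux_eq (hab : a < b) (hz : z ∈ slab a b M)
    (hp : MDifferentiableWithinAt IX 𝓘(ℝ, ℝ) p (slab a b M) z)
    (hρ : MDifferentiableWithinAt IX 𝓘(ℝ, ℝ) ρ (slab a b M) z) (hρz : ρ z ≠ 0)
    (hu : MDifferentiableWithinAt IX IX.tangent u.toBundle (slab a b M) z) :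
    dvg G (fun x => (ρ x * bernoulli G γ p ρ u x) • u x) z
      - ρ z * G.inner z (f z) (u z) - ρ z * r z =
      ρ z * resBernoulli G γ f r p ρ u z +
        bernoulli G γ p ρ u z * dvg G (fun x => ρ x • u x) z := by
  have hE := mdifferentiableWithinAt_bernoulli G (γ := γ) hz hp hρ hρz hu
  rw [dvg_smul G hab (f := fun x => ρ x * bernoulli G γ p ρ u x) hz (hρ.mul hE) hu,
    dvg_smul G hab hz hρ hu, scalarD_mul hab u hz hρ hE, resBernoulli]
  ring

end Residuals

section GasFlows

/-- The regularity and positivity assumptions on the pressure `p`, the density `ρ` and the velocity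
`u` of a gas in `[a, b] × M`, which need not satisfy any equation of motion. -/
structure IsGasFlow {M : Type*} [TopologicalSpace M] [ChartedSpace (EuclideanSpace ℝ (Fin 2)) M]
    [IsManifold (𝓡 2) ∞ M] (a b : ℝ) (p ρ : ScalarField M) (u : VField M) : Prop where
  pressure : ContMDiffOn IX 𝓘(ℝ, ℝ) 1 p (slab a b M)
  density : ContMDiffOn IX 𝓘(ℝ, ℝ) 1 ρ (slab a b M)
  velocity : ContMDiffOn IX IX.tangent 1 u.toBundle (slab a b M)
  pressure_pos : ∀ z ∈ slab a b M, 0 < p z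
  density_pos : ∀ z ∈ slab a b M, 0 < ρ z

theorem pressure_pos_of_state {γ k₀ cν p ρ s : ℝ} (hk₀ : 0 < k₀) (hρ : 0 < ρ)
    (hstate : p = k₀ * Real.exp (s / cν) * ρ ^ γ) : 0 < p :=
  hstate ▸ mul_pos (mul_pos hk₀ (Real.exp_pos _)) (Real.rpow_pos_of_pos hρ _)

variable {M : Type*} [TopologicalSpace M] [ChartedSpace (EuclideanSpace ℝ (Fin 2)) M]
  [IsManifold (𝓡 2) ∞ M] {a b γ k₀ cν : ℝ} (G : SlabMetric a b M)
  {f : VField M} {r p ρ s : ScalarField M} {u : VField M}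

namespace IsGasFlow

theorem mdifferentiableOn_pressure (h : IsGasFlow a b p ρ u) :
    MDifferentiableOn IX 𝓘(ℝ, ℝ) p (slab a b M) :=
  h.pressure.mdifferentiableOn one_ne_zero

theorem mdifferentiableOn_density (h : IsGasFlow a b p ρ u) :
    MDifferentiableOn IX 𝓘(ℝ, ℝ) ρ (slab a b M) :=
  h.density.mdifferentiableOn one_ne_zero

theorem mdifferentiableOn_velocity (h : IsGasFlow a b p ρ u) :
    MDifferentiableOn IX IX.tangent u.toBundle (slab a b M) :=
  h.velocity.mdifferentiableOn one_ne_zero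

end IsGasFlow

theorem SolvesEuler.residuals_eq_zero (h : SolvesEuler G γ f r p ρ u) (hab : a < b) (hγ : 1 < γ)
    (hflow : IsGasFlow a b p ρ u)
    (hstate : ∀ z ∈ slab a b M, p z = entropyA k₀ cν s z * ρ z ^ γ) :
    ∀ z ∈ openSlab a b M, resMomentum G f p ρ u z = 0 ∧
      resEntropy a b γ k₀ cν r ρ s u z = 0 ∧ resMass G γ r p ρ u z = 0 := by
  intro z hz
  have hzs := openSlab_subset_slab hz
  have hp := hflow.mdifferentiableOn_pressure z hzs
  have hρ := hflow.mdifferentiableOn_density z hzs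
  have hu := hflow.mdifferentiableOn_velocity z hzs
  have hρz := hflow.density_pos z hzs
  have hmomentum : resMomentum G f p ρ u z = 0 := by
    have h' := h.momentum z hz
    rw [momentum_flux_eq G hab hzs hρ hρz.ne' hu, h.mass z hz, zero_smul, add_zero] at h'
    exact (smul_eq_zero.1 h').resolve_left hρz.ne'
  have hbernoulli : resBernoulli G γ f r p ρ u z = 0 := by
    have h' := h.energy z hz
    rw [energy_flux_eq G hab hzs hp hρ hρz.ne' hu, h.mass z hz, mul_zero, add_zero] at h'
    exact (mul_eq_zero.1 h').resolve_left hρz.ne'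
  have hentropy : resEntropy a b γ k₀ cν r ρ s u z = 0 := by
    rw [resBernoulli_eq G hab hγ hzs hp hρ hflow.density_pos hstate hu, hmomentum, map_zero,
      zero_apply, zero_add] at hbernoulli
    exact (mul_eq_zero.1 hbernoulli).resolve_left
      (div_ne_zero (Real.rpow_pos_of_pos hρz _).ne' (sub_pos.2 hγ).ne')
  refine ⟨hmomentum, hentropy, ?_⟩
  rw [resMass_eq G hab (zero_lt_one.trans hγ).ne' hzs hp (hflow.pressure_pos z hzs).ne' hρ
    hflow.density_pos hstate hu, h.mass z hz, hentropy, zero_div, mul_zero, add_zero]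

theorem solvesEuler_of_residuals_eq_zero (hab : a < b) (hγ : 1 < γ)
    (hflow : IsGasFlow a b p ρ u)
    (hstate : ∀ z ∈ slab a b M, p z = entropyA k₀ cν s z * ρ z ^ γ)
    (hmomentum : ∀ z ∈ openSlab a b M, resMomentum G f p ρ u z = 0)
    (hentropy : ∀ z ∈ openSlab a b M, resEntropy a b γ k₀ cν r ρ s u z = 0)
    (hmass : ∀ z ∈ openSlab a b M, resMass G γ r p ρ u z = 0) :
    SolvesEuler G γ f r p ρ u := by
  have hp := hflow.mdifferentiableOn_pressure
  have hρ := hflow.mdifferentiableOn_density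
  have hu := hflow.mdifferentiableOn_velocity
  have hflux : ∀ z ∈ openSlab a b M, dvg G (fun x => ρ x • u x) z = 0 := fun z hz => by
    have hzs := openSlab_subset_slab hz
    have h := hmass z hz
    rw [resMass_eq G hab (zero_lt_one.trans hγ).ne' hzs (hp z hzs) (hflow.pressure_pos z hzs).ne'
      (hρ z hzs) hflow.density_pos hstate (hu z hzs), hentropy z hz, mul_zero, add_zero] at h
    exact (div_eq_zero_iff.1 h).resolve_right (hflow.density_pos z hzs).ne'
  refine ⟨fun z hz => ?_, hflux, fun z hz => ?_⟩ <;>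
    have hzs := openSlab_subset_slab hz <;> have hρz := (hflow.density_pos z hzs).ne'
  · rw [momentum_flux_eq G hab hzs (hρ z hzs) hρz (hu z hzs), hmomentum z hz, hflux z hz,
      smul_zero, zero_smul, add_zero]
  · rw [energy_flux_eq G hab hzs (hp z hzs) (hρ z hzs) hρz (hu z hzs), hflux z hz,
      resBernoulli_eq G hab hγ hzs (hp z hzs) (hρ z hzs) hflow.density_pos hstate (hu z hzs),
      hmomentum z hz, hentropy z hz, map_zero, zero_apply]
    simp only [mul_zero, add_zero]

theorem IsGasFlow.contMDiffOn_sonicSq (h : IsGasFlow a b p ρ u) (γ : ℝ) :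
    ContMDiffOn IX 𝓘(ℝ, ℝ) 1 (sonicSq γ p ρ) (slab a b M) :=
  (contMDiffOn_const.mul h.pressure).div₀ h.density fun z hz => (h.density_pos z hz).ne'

theorem IsGasFlow.sonicSq_ne_zero (h : IsGasFlow a b p ρ u) (hγ : γ ≠ 0) {z : ℝ × M}
    (hz : z ∈ slab a b M) : sonicSq γ p ρ z ≠ 0 :=
  div_ne_zero (mul_ne_zero hγ (h.pressure_pos z hz).ne') (h.density_pos z hz).ne'

theorem IsGasFlow.contMDiffOn_inv_density_smul_grad (h : IsGasFlow a b p ρ u) (hab : a < b)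
    (hp : ContMDiffOn IX 𝓘(ℝ, ℝ) 2 p (openSlab a b M)) :
    ContMDiffOn IX IX.tangent 1 (VField.toBundle fun x => (ρ x)⁻¹ • grad G p x)
      (openSlab a b M) :=
  ((h.density.mono openSlab_subset_slab).inv₀ fun z hz =>
    (h.density_pos z (openSlab_subset_slab hz)).ne').smul_section
    (contMDiffOn_grad G hab openSlab_subset_slab isOpen_openSlab.uniqueMDiffOn (by norm_cast)
      (by norm_num) h.mdifferentiableOn_pressure hp)

theorem hasDerivAt_resMass_integralCurve (hab : a < b) (hγ : γ ≠ 0)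
    (hf : ContMDiffOn IX IX.tangent 1 f.toBundle (openSlab a b M))
    (hr : ContMDiffOn IX 𝓘(ℝ, ℝ) 1 r (openSlab a b M))
    (hp : ContMDiffOn IX 𝓘(ℝ, ℝ) 2 p (openSlab a b M))
    (hflow : IsGasFlow a b p ρ u)
    (hmomentum : ∀ z ∈ openSlab a b M, resMomentum G f p ρ u z = 0)
    {X : ℝ → ℝ × M} (hX : IsMIntegralCurveAt X u 0) (hX0 : X 0 ∈ openSlab a b M) :
    HasDerivAt (fun t => resMass G γ r p ρ u (X t)) (pressureOp G γ f r p ρ u (X 0)) 0 := by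
  have hsub : openSlab a b M ⊆ slab a b M := openSlab_subset_slab
  have hnhds : openSlab a b M ∈ 𝓝 (X 0) := isOpen_openSlab.mem_nhds hX0
  have hgrad := hflow.contMDiffOn_inv_density_smul_grad G hab hp
  have hDp : ContMDiffOn IX 𝓘(ℝ, ℝ) 1 (fun x => scalarD a b u p x / (γ * p x))
      (openSlab a b M) :=
    (contMDiffOn_scalarD hab hsub isOpen_openSlab.uniqueMDiffOn (by norm_cast) (by norm_num)
      hflow.mdifferentiableOn_pressure hp (hflow.velocity.mono hsub)).div₀
      (contMDiffOn_const.mul (hflow.pressure.mono hsub)) fun z hz =>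
        mul_ne_zero hγ (hflow.pressure_pos z (hsub hz)).ne'
  have hheat : ContMDiffOn IX 𝓘(ℝ, ℝ) 1 (fun x => r x / sonicSq γ p ρ x) (openSlab a b M) :=
    hr.div₀ ((hflow.contMDiffOn_sonicSq γ).mono hsub) fun z hz =>
      hflow.sonicSq_ne_zero hγ (hsub hz)
  -- The momentum equation makes `D_u u` of class `C¹`, one order better than `u` alone gives.
  have hdvg := hasDerivAt_dvg_integralCurve G hab (A := fun x => f x - (ρ x)⁻¹ • grad G p x)
    hflow.velocity (hf.sub_section hgrad)
    (fun x hx => (eq_sub_of_add_eq (sub_eq_zero.1 (hmomentum x hx))).symm) hX hX0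
  rw [dvg_sub G hab (v := fun x => (ρ x)⁻¹ • grad G p x) (hsub hX0)
    ((hf.mdifferentiableOn one_ne_zero).mdifferentiableAt hnhds).mdifferentiableWithinAt
    ((hgrad.mdifferentiableOn one_ne_zero).mdifferentiableAt hnhds).mdifferentiableWithinAt] at hdvg
  have hDp' := hasDerivAt_comp_integralCurve hX hX0
    ((hDp.mdifferentiableOn one_ne_zero).mdifferentiableAt hnhds)
  have hheat' := hasDerivAt_comp_integralCurve hX hX0
    ((hheat.mdifferentiableOn one_ne_zero).mdifferentiableAt hnhds)
  refine (((hDp'.fun_add hdvg).fun_sub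
    (hheat'.const_mul (γ - 1))).congr_deriv ?_).congr_of_eventuallyEq
    (Filter.Eventually.of_forall fun t => ?_)
  · rw [pressureOp]
    ring
  · simp only [resMass]
    ring

end GasFlows

section Closure

variable {M : Type*} [TopologicalSpace M] {a b : ℝ}

theorem eq_zero_of_continuousOn_slab (hab : a < b) {g : ScalarField M}
    (hg : ContinuousOn g (slab a b M)) (h : ∀ z ∈ openSlab a b M, g z = 0) {z : ℝ × M}
    (hz : z ∈ slab a b M) : g z = 0 :=
  (EqOn.of_subset_closure (g := fun _ => 0) h hg continuousOn_const openSlab_subset_slab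
    (slab_subset_closure_openSlab hab)) hz

variable [ChartedSpace (EuclideanSpace ℝ (Fin 2)) M] [IsManifold (𝓡 2) ∞ M]
  (G : SlabMetric a b M) {γ k₀ cν : ℝ} {f : VField M} {r p ρ s : ScalarField M} {u : VField M}

theorem contMDiffOn_entropyA (hflow : IsGasFlow a b p ρ u)
    (hstate : ∀ z ∈ slab a b M, p z = entropyA k₀ cν s z * ρ z ^ γ) :
    ContMDiffOn IX 𝓘(ℝ, ℝ) 1 (entropyA k₀ cν s) (slab a b M) := by
  have hrpow : ContDiffOn ℝ 1 (fun t : ℝ => t ^ (-γ)) (Ioi 0) := fun t ht =>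
    (Real.contDiffAt_rpow_const_of_ne (ne_of_gt ht)).contDiffWithinAt
  exact (hflow.pressure.mul (hrpow.contMDiffOn.comp hflow.density hflow.density_pos)).congr
    fun z hz => entropyA_eq (hflow.density_pos z hz) (hstate z hz)

theorem continuousOn_resEntropy (hab : a < b) (hr : ContinuousOn r (slab a b M))
    (hflow : IsGasFlow a b p ρ u)
    (hstate : ∀ z ∈ slab a b M, p z = entropyA k₀ cν s z * ρ z ^ γ) :
    ContinuousOn (resEntropy a b γ k₀ cν r ρ s u) (slab a b M) := by
  have hA := contMDiffOn_entropyA hflow hstate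
  have : ContMDiffVectorBundle 0 EX (TangentSpace IX : ℝ × M → Type _) IX :=
    ContMDiffVectorBundle.of_le (n := 1) (by norm_num)
  have hDA : ContMDiffOn IX 𝓘(ℝ, ℝ) 0 (scalarD a b u (entropyA k₀ cν s)) (slab a b M) :=
    contMDiffOn_scalarD hab Subset.rfl (fun _ => uniqueMDiffWithinAt_slab hab) (by norm_cast)
      (by norm_num) (hA.mdifferentiableOn one_ne_zero) hA (hflow.velocity.of_le (by norm_num))
  refine hDA.continuousOn.sub ((continuousOn_const.div (hflow.density.continuousOn.rpow_const
    fun z hz => Or.inl (hflow.density_pos z hz).ne') fun z hz => ?_).mul hr)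
  exact (Real.rpow_pos_of_pos (hflow.density_pos z hz) _).ne'

theorem continuousOn_resMass (hab : a < b) (hγ : γ ≠ 0) (hr : ContinuousOn r (slab a b M))
    (hflow : IsGasFlow a b p ρ u) : ContinuousOn (resMass G γ r p ρ u) (slab a b M) := by
  have : ContMDiffVectorBundle 0 EX (TangentSpace IX : ℝ × M → Type _) IX :=
    ContMDiffVectorBundle.of_le (n := 1) (by norm_num)
  have hDp : ContMDiffOn IX 𝓘(ℝ, ℝ) 0 (scalarD a b u p) (slab a b M) :=
    contMDiffOn_scalarD hab Subset.rfl (fun _ => uniqueMDiffWithinAt_slab hab) (by norm_cast)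
      (by norm_num) hflow.mdifferentiableOn_pressure hflow.pressure
      (hflow.velocity.of_le (by norm_num))
  exact ((hDp.continuousOn.div (continuousOn_const.mul hflow.pressure.continuousOn)
    fun z hz => mul_ne_zero hγ (hflow.pressure_pos z hz).ne').add
      (continuousOn_dvg G hab hflow.velocity)).sub
    ((continuousOn_const.div (hflow.contMDiffOn_sonicSq γ).continuousOn
      fun z hz => hflow.sonicSq_ne_zero hγ hz).mul hr)

theorem continuousOn_resMomentum (hab : a < b) (hf : ContinuousOn f.toBundle (slab a b M))
    (hflow : IsGasFlow a b p ρ u) :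
    ContinuousOn (resMomentum G f p ρ u).toBundle (slab a b M) := by
  have : ContMDiffVectorBundle 0 EX (TangentSpace IX : ℝ × M → Type _) IX :=
    ContMDiffVectorBundle.of_le (n := 1) (by norm_num)
  have hgrad : ContMDiffOn IX IX.tangent 0 (grad G p).toBundle (slab a b M) :=
    contMDiffOn_grad G hab Subset.rfl (fun _ => uniqueMDiffWithinAt_slab hab) (n := 1)
      (by norm_cast) (by norm_num) hflow.mdifferentiableOn_pressure hflow.pressure
  have hinv := (hflow.density.of_le (n := 1) (m := 0) (by norm_num)).inv₀ fun z hz =>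
    (hflow.density_pos z hz).ne'
  have hcov := continuousOn_covDeriv G hab hflow.velocity hflow.velocity.continuousOn
  exact (((contMDiffOn_zero_iff.2 hcov).add_section (hinv.smul_section hgrad)).sub_section
    (contMDiffOn_zero_iff.2 hf)).continuousOn

theorem resMomentum_eq_zero_of_openSlab (hab : a < b)
    (hf : ContinuousOn f.toBundle (slab a b M)) (hflow : IsGasFlow a b p ρ u)
    (h : ∀ z ∈ openSlab a b M, resMomentum G f p ρ u z = 0) {z : ℝ × M} (hz : z ∈ slab a b M) :
    resMomentum G f p ρ u z = 0 := by
  have : ContMDiffVectorBundle 0 EX (TangentSpace IX : ℝ × M → Type _) IX :=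
    ContMDiffVectorBundle.of_le (n := 1) (by norm_num)
  have hR : ContMDiffOn IX IX.tangent 0 (resMomentum G f p ρ u).toBundle (slab a b M) :=
    contMDiffOn_zero_iff.2 (continuousOn_resMomentum G hab hf hflow)
  have hnorm : G.inner z (resMomentum G f p ρ u z) (resMomentum G f p ρ u z) = 0 :=
    eq_zero_of_continuousOn_slab hab
      (contMDiffOn_inner_section G (by norm_num) Subset.rfl hR hR).continuousOn
      (fun x hx => by rw [h x hx, map_zero]) hz
  by_contra hne
  exact (G.pos z hz _ hne).ne' hnorm

theorem residuals_eq_zero_of_openSlab (hab : a < b) (hγ : 1 < γ)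
    (hf : ContinuousOn f.toBundle (slab a b M)) (hr : ContinuousOn r (slab a b M))
    (hflow : IsGasFlow a b p ρ u)
    (hstate : ∀ z ∈ slab a b M, p z = entropyA k₀ cν s z * ρ z ^ γ)
    (hmomentum : ∀ z ∈ openSlab a b M, resMomentum G f p ρ u z = 0)
    (hentropy : ∀ z ∈ openSlab a b M, resEntropy a b γ k₀ cν r ρ s u z = 0) :
    ∀ z ∈ slab a b M, resMomentum G f p ρ u z = 0 ∧ resEntropy a b γ k₀ cν r ρ s u z = 0 ∧
      resBernoulli G γ f r p ρ u z = 0 := by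
  intro z hz
  have hmomentum' := resMomentum_eq_zero_of_openSlab G hab hf hflow hmomentum hz
  have hentropy' := eq_zero_of_continuousOn_slab hab
    (continuousOn_resEntropy hab hr hflow hstate) hentropy hz
  refine ⟨hmomentum', hentropy', ?_⟩
  rw [resBernoulli_eq G hab hγ hz (hflow.mdifferentiableOn_pressure z hz)
    (hflow.mdifferentiableOn_density z hz) hflow.density_pos hstate
    (hflow.mdifferentiableOn_velocity z hz), hmomentum', hentropy', map_zero, zero_apply,
    mul_zero, add_zero]

end Closure

section Transport

theorem eventually_lt_comp_mul {f : ℝ → ℝ} {f' σ : ℝ} (hf : HasDerivAt f f' 0)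
    (hσ : 0 < σ * f') : ∀ᶠ t in 𝓝[>] (0 : ℝ), f 0 < f (σ * t) := by
  have hcomp : HasDerivAt (fun t => f (σ * t)) (σ * f') 0 :=
    (HasDerivAt.comp_of_eq (h := fun t => σ * t) 0 hf ((hasDerivAt_id 0).const_mul σ)
      (mul_zero σ).symm).congr_deriv (by rw [mul_one, mul_comm])
  filter_upwards [hcomp.tendsto_slope_zero_right.eventually (lt_mem_nhds hσ),
    self_mem_nhdsWithin] with t hslope ht
  rw [zero_add, mul_zero, smul_eq_mul] at hslope
  exact sub_pos.1 (pos_of_mul_pos_right hslope (inv_pos.2 ht).le)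

theorem eventually_lt_sq_mul_exp {x w : ℝ → ℝ} {v l c : ℝ} (hx : HasDerivAt x v 0)
    (hw : HasDerivAt w (-(l * w 0)) 0) (hv : v ≠ 0) (hw0 : w 0 ≠ 0) (hc : l / v < c) :
    ∀ᶠ t in 𝓝[>] (0 : ℝ), x 0 < x (v * t) ∧
      w 0 ^ 2 * Real.exp (2 * c * x 0) < w (v * t) ^ 2 * Real.exp (2 * c * x (v * t)) := by
  have hψ : HasDerivAt (fun t => w t ^ 2 * Real.exp (2 * c * x t))
      (2 * w 0 ^ 2 * Real.exp (2 * c * x 0) * (c * v - l)) 0 := by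
    refine ((hw.fun_pow 2).fun_mul (hx.const_mul (2 * c)).exp).congr_deriv ?_
    push_cast
    ring
  have hpos : 0 < v * (2 * w 0 ^ 2 * Real.exp (2 * c * x 0) * (c * v - l)) := by
    have hfactor : v * (2 * w 0 ^ 2 * Real.exp (2 * c * x 0) * (c * v - l)) =
        2 * w 0 ^ 2 * Real.exp (2 * c * x 0) * v ^ 2 * (c - l / v) := by
      field_simp
    rw [hfactor]
    have := sub_pos.2 hc
    positivity
  exact (eventually_lt_comp_mul hx (mul_self_pos.2 hv)).and (eventually_lt_comp_mul hψ hpos)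

theorem eq_zero_of_transport {M : Type*} [TopologicalSpace M] [CompactSpace M] {a b : ℝ}
    {w v L : ℝ × M → ℝ} (hw : ContinuousOn w (slab a b M)) (hb : ∀ x, w (b, x) = 0)
    (hv : ContinuousOn v (slab a b M)) (hv0 : ∀ z ∈ slab a b M, v z ≠ 0)
    (hL : ContinuousOn L (slab a b M))
    (hX : ∀ z ∈ openSlab a b M, ∃ X : ℝ → ℝ × M, X 0 = z ∧
      HasDerivAt (fun t => (X t).1) (v z) 0 ∧ HasDerivAt (fun t => w (X t)) (-(L z * w z)) 0) :
    ∀ z ∈ openSlab a b M, w z = 0 := by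
  intro z₁ hz₁
  by_contra hwz₁
  obtain ⟨C, hC⟩ := (isCompact_Icc.prod isCompact_univ :
    IsCompact (slab a b M)).exists_bound_of_continuousOn (hL.div hv hv0)
  -- The weight makes `ψ` strictly increasing along streamlines in the direction of growing `x⁰`.
  let ψ : ℝ × M → ℝ := fun z => w z ^ 2 * Real.exp (2 * (C + 1) * z.1)
  have hz₁K : z₁ ∈ Icc z₁.1 b ×ˢ (univ : Set M) := ⟨⟨le_rfl, hz₁.1.2.le⟩, trivial⟩
  have hψ : ContinuousOn ψ (Icc z₁.1 b ×ˢ univ) :=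
    ((hw.mono (prod_mono (Icc_subset_Icc_left hz₁.1.1.le) Subset.rfl)).pow 2).mul
      (Continuous.continuousOn (by fun_prop))
  obtain ⟨z, hzK, hmax⟩ :=
    (isCompact_Icc.prod isCompact_univ).exists_isMaxOn ⟨z₁, hz₁K⟩ hψ
  have hwz : w z ≠ 0 := fun h => by
    have hpos : 0 < ψ z₁ := by positivity
    have hle : ψ z₁ ≤ ψ z := hmax hz₁K
    simp only [ψ, h] at hpos hle
    linarith
  have hzb : z.1 < b := lt_of_le_of_ne hzK.1.2 fun h => hwz (by rw [← hb z.2, ← h])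
  have hz : z ∈ openSlab a b M := ⟨⟨hz₁.1.1.trans_le hzK.1.1, hzb⟩, trivial⟩
  obtain ⟨X, rfl, hX, hwX⟩ := hX z hz
  have hlt : L (X 0) / v (X 0) < C + 1 :=
    ((le_abs_self _).trans (hC _ (openSlab_subset_slab hz))).trans_lt (lt_add_one C)
  have hltb : ∀ᶠ t in 𝓝[>] (0 : ℝ), (X (v (X 0) * t)).1 < b := by
    have hcont : Filter.Tendsto (fun t => v (X 0) * t) (𝓝[>] (0 : ℝ)) (𝓝 0) :=
      ((continuous_const_mul (v (X 0))).tendsto' 0 0 (mul_zero _)).mono_left nhdsWithin_le_nhds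
    exact hcont.eventually (hX.continuousAt.eventually (gt_mem_nhds hzb))
  obtain ⟨t, ⟨hfst, hψt⟩, htb⟩ := ((eventually_lt_sq_mul_exp hX hwX
    (hv0 _ (openSlab_subset_slab hz)) hwz hlt).and hltb).exists
  exact (hmax ⟨⟨hzK.1.1.trans hfst.le, htb.le⟩, trivial⟩).not_gt hψt

end Transport

section TransversalFlow

variable {M : Type*} [TopologicalSpace M] [ChartedSpace (EuclideanSpace ℝ (Fin 2)) M]
  {a b : ℝ}

theorem scalarD_fst (u : VField M) {z : ℝ × M} (hab : a < b) (hz : z ∈ slab a b M) :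
    scalarD a b u Prod.fst z = comp z 0 (u z) := by
  have hrep : scalarRep (Prod.fst : ℝ × M → ℝ) z = coordFun 0 :=
    funext fun y => extChartAt_symm_fst z y
  rw [scalarD_eq_fderivWithin_self u mdifferentiableAt_fst.mdifferentiableWithinAt, hrep,
    (coordFun 0).fderivWithin (uniqueDiffOn_coordSlab hab z _
      (extChartAt_mem_coordSlab hz (mem_extChartAt_source z)))]
  rfl

variable [IsManifold (𝓡 2) ∞ M] (G : SlabMetric a b M)

theorem SlabMetric.eq_zero_of_inner {z : ℝ × M} (hz : z ∈ slab a b M) {R v : TangentSpace IX z}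
    (htangential : ∀ α : Fin 2, G.inner z R (pd z α.succ) = 0) (hv : G.inner z R v = 0)
    (htransversal : G.inner z v (pd z 0) ≠ 0) : R = 0 := by
  have hnormal : ∀ w : TangentSpace IX z, G.inner z R w = comp z 0 w * G.inner z R (pd z 0) := by
    intro w
    have h := map_eq_sum_coordFun (F := ℝ) (G.inner z R) w
    rw [Fin.sum_univ_succ] at h
    refine h.trans (add_eq_left.2 (Finset.sum_eq_zero fun α _ => ?_))
    exact (congrArg _ (htangential α)).trans (smul_zero _)
  have hR0 : G.inner z R (pd z 0) = 0 := by
    rw [hnormal v] at hv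
    rw [G.inner_pd_zero z hz] at htransversal
    exact (mul_eq_zero.1 hv).resolve_left htransversal
  by_contra hne
  refine (G.pos z hz R hne).ne' ?_
  rw [hnormal R, hR0, mul_zero]

end TransversalFlow

section PressureEquation

variable {M : Type*} [TopologicalSpace M] [ChartedSpace (EuclideanSpace ℝ (Fin 2)) M]
  [IsManifold (𝓡 2) ∞ M] {a b γ : ℝ} (G : SlabMetric a b M) {f : VField M}
  {r p ρ : ScalarField M} {u : VField M}

theorem exists_isMIntegralCurveAt_openSlab
    (hu : ContMDiffOn IX IX.tangent 1 u.toBundle (slab a b M)) {z : ℝ × M}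
    (hz : z ∈ openSlab a b M) : ∃ X : ℝ → ℝ × M, X 0 = z ∧ IsMIntegralCurveAt X u 0 :=
  exists_isMIntegralCurveAt_of_contMDiffAt_boundaryless 0 (hu.contMDiffAt (slab_mem_nhds hz))

theorem pressureOp_eq_zero (hab : a < b) (hγ : γ ≠ 0)
    (hf : ContMDiffOn IX IX.tangent 1 f.toBundle (openSlab a b M))
    (hr : ContMDiffOn IX 𝓘(ℝ, ℝ) 1 r (openSlab a b M))
    (hp : ContMDiffOn IX 𝓘(ℝ, ℝ) 2 p (openSlab a b M)) (hflow : IsGasFlow a b p ρ u)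
    (hmomentum : ∀ z ∈ openSlab a b M, resMomentum G f p ρ u z = 0)
    (hmass : ∀ z ∈ openSlab a b M, resMass G γ r p ρ u z = 0) {z : ℝ × M}
    (hz : z ∈ openSlab a b M) : pressureOp G γ f r p ρ u z = 0 := by
  obtain ⟨X, rfl, hX⟩ := exists_isMIntegralCurveAt_openSlab hflow.velocity hz
  refine ((hasDerivAt_resMass_integralCurve G hab hγ hf hr hp hflow hmomentum hX
    hz).congr_of_eventuallyEq (f₁ := fun _ => 0) ?_).unique (hasDerivAt_const 0 0)
  filter_upwards [hX.continuousAt.eventually (isOpen_openSlab.mem_nhds hz)] with t ht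
  exact (hmass _ ht).symm

theorem resMass_eq_zero_of_pressureOp [CompactSpace M] (hab : a < b) (hγ : γ ≠ 0)
    (hf : ContMDiffOn IX IX.tangent 1 f.toBundle (openSlab a b M))
    (hr : ContMDiffOn IX 𝓘(ℝ, ℝ) 1 r (openSlab a b M)) (hr' : ContinuousOn r (slab a b M))
    (hp : ContMDiffOn IX 𝓘(ℝ, ℝ) 2 p (openSlab a b M)) (hflow : IsGasFlow a b p ρ u)
    (hu0 : ∀ z ∈ slab a b M, G.inner z (u z) (pd z 0) ≠ 0)
    (hmomentum : ∀ z ∈ openSlab a b M, resMomentum G f p ρ u z = 0)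
    {L : ℝ × M → ℝ →L[ℝ] ℝ} (hL : ContinuousOn L (slab a b M))
    (hpressure : ∀ z ∈ openSlab a b M,
      pressureOp G γ f r p ρ u z + L z (resMass G γ r p ρ u z) = 0)
    (hb : ∀ x, resMass G γ r p ρ u (b, x) = 0) :
    ∀ z ∈ openSlab a b M, resMass G γ r p ρ u z = 0 := by
  have : ContMDiffVectorBundle 0 EX (TangentSpace IX : ℝ × M → Type _) IX :=
    ContMDiffVectorBundle.of_le (n := 1) (by norm_num)
  have hv : ContMDiffOn IX 𝓘(ℝ, ℝ) 0 (scalarD a b u Prod.fst) (slab a b M) :=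
    contMDiffOn_scalarD hab Subset.rfl (fun _ => uniqueMDiffWithinAt_slab hab) (n := 1)
      (by norm_cast) (by norm_num) mdifferentiable_fst.mdifferentiableOn contMDiffOn_fst
      (hflow.velocity.of_le (by norm_num))
  refine eq_zero_of_transport (L := fun z => L z 1) (continuousOn_resMass G hab hγ hr' hflow) hb
    hv.continuousOn (fun z hz => ?_) (hL.clm_apply continuousOn_const) fun z hz => ?_
  · rw [scalarD_fst u hab hz, ← G.inner_pd_zero z hz]
    exact hu0 z hz
  obtain ⟨X, rfl, hX⟩ := exists_isMIntegralCurveAt_openSlab hflow.velocity hz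
  refine ⟨X, rfl, hasDerivAt_comp_integralCurve hX hz mdifferentiableAt_fst,
    (hasDerivAt_resMass_integralCurve G hab hγ hf hr hp hflow hmomentum hX hz).congr_deriv ?_⟩
  have hlinear : L (X 0) (resMass G γ r p ρ u (X 0)) =
      L (X 0) 1 * resMass G γ r p ρ u (X 0) := by
    rw [mul_comm, ← smul_eq_mul, ← map_smul, smul_eq_mul, mul_one]
  rw [← hlinear]
  exact eq_neg_of_add_eq_zero_left (hpressure _ hz)

end PressureEquation

section Tangential

variable {M : Type*} [TopologicalSpace M] [ChartedSpace (EuclideanSpace ℝ (Fin 2)) M]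
  [IsManifold (𝓡 2) ∞ M] {a b γ k₀ cν : ℝ} (G : SlabMetric a b M) {f : VField M}
  {r p ρ s : ScalarField M} {u : VField M}

theorem resMomentum_eq_zero_of_tangential (hab : a < b) (hγ : 1 < γ)
    (hflow : IsGasFlow a b p ρ u)
    (hstate : ∀ z ∈ slab a b M, p z = entropyA k₀ cν s z * ρ z ^ γ) {z : ℝ × M}
    (hz : z ∈ slab a b M) (hu0 : G.inner z (u z) (pd z 0) ≠ 0)
    (hentropy : resEntropy a b γ k₀ cν r ρ s u z = 0)
    (hbernoulli : resBernoulli G γ f r p ρ u z = 0)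
    (htangential : ∀ α : Fin 2, G.inner z (resMomentum G f p ρ u z) (pd z α.succ) = 0) :
    resMomentum G f p ρ u z = 0 := by
  refine G.eq_zero_of_inner hz htangential ?_ hu0
  rwa [resBernoulli_eq G hab hγ hz (hflow.mdifferentiableOn_pressure z hz)
    (hflow.mdifferentiableOn_density z hz) hflow.density_pos hstate
    (hflow.mdifferentiableOn_velocity z hz), hentropy, mul_zero, add_zero] at hbernoulli

end Tangential

section Decomposition

variable {M : Type*} [TopologicalSpace M] [ChartedSpace (EuclideanSpace ℝ (Fin 2)) M]
  [IsManifold (𝓡 2) ∞ M]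
  {a b γ k₀ cν : ℝ} (G : SlabMetric a b M) {f : VField M} {r p ρ s : ScalarField M} {u : VField M}
  {L0 : ℝ × M → ℝ →L[ℝ] ℝ} {L1 L2 K1 K2 : ℝ × M → ℝ → ℝ}
  {L3 K3 : (z : ℝ × M) → TangentSpace IX z → ℝ}

theorem SolvesEuler.solvesDecomposed (h : SolvesEuler G γ f r p ρ u) (hab : a < b) (hγ : 1 < γ)
    (hf : ContMDiffOn IX IX.tangent 1 f.toBundle (openSlab a b M))
    (hf' : ContinuousOn f.toBundle (slab a b M))
    (hr : ContMDiffOn IX 𝓘(ℝ, ℝ) 1 r (openSlab a b M)) (hr' : ContinuousOn r (slab a b M))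
    (hp : ContMDiffOn IX 𝓘(ℝ, ℝ) 2 p (openSlab a b M)) (hflow : IsGasFlow a b p ρ u)
    (hstate : ∀ z ∈ slab a b M, p z = entropyA k₀ cν s z * ρ z ^ γ)
    (hL1 : ∀ z, L1 z 0 = 0) (hL2 : ∀ z, L2 z 0 = 0) (hL3 : ∀ z, L3 z 0 = 0)
    (hK1 : ∀ z, K1 z 0 = 0) (hK2 : ∀ z, K2 z 0 = 0) (hK3 : ∀ z, K3 z 0 = 0) :
    SolvesDecomposed G γ k₀ cν f r L0 L1 L2 L3 K1 K2 K3 p ρ s u := by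
  have hγ0 : γ ≠ 0 := (zero_lt_one.trans hγ).ne'
  have hsub : openSlab a b M ⊆ slab a b M := openSlab_subset_slab
  have hb : ∀ x : M, (b, x) ∈ slab a b M := fun x => ⟨right_mem_Icc.2 hab.le, trivial⟩
  have hres := h.residuals_eq_zero G hab hγ hflow hstate
  have hmass := fun z hz => (hres z hz).2.2
  have hzero := residuals_eq_zero_of_openSlab G hab hγ hf' hr' hflow hstate
    (fun z hz => (hres z hz).1) fun z hz => (hres z hz).2.1
  refine ⟨fun z hz => (hres z hz).2.1, fun z hz => (hzero z (hsub hz)).2.2, fun z hz => ?_,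
    fun z hz α => by rw [(hres z hz).1, map_zero, zero_apply], fun x => ?_⟩
  · have hpressure := pressureOp_eq_zero G hab hγ0 hf hr hp hflow (fun z hz => (hres z hz).1)
      hmass hz
    simp only [hpressure, hmass z hz, hzero z (hsub hz), map_zero, hL1, hL2, hL3, add_zero]
  · have hmassb := eq_zero_of_continuousOn_slab hab (continuousOn_resMass G hab hγ0 hr' hflow)
      hmass (hb x)
    simp only [hmassb, hzero _ (hb x), hK1, hK2, hK3, add_zero]

theorem SolvesDecomposed.solvesEuler [CompactSpace M]
    (h : SolvesDecomposed G γ k₀ cν f r L0 L1 L2 L3 K1 K2 K3 p ρ s u) (hab : a < b) (hγ : 1 < γ)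
    (hf : ContMDiffOn IX IX.tangent 1 f.toBundle (openSlab a b M))
    (hf' : ContinuousOn f.toBundle (slab a b M))
    (hr : ContMDiffOn IX 𝓘(ℝ, ℝ) 1 r (openSlab a b M)) (hr' : ContinuousOn r (slab a b M))
    (hp : ContMDiffOn IX 𝓘(ℝ, ℝ) 2 p (openSlab a b M)) (hflow : IsGasFlow a b p ρ u)
    (hstate : ∀ z ∈ slab a b M, p z = entropyA k₀ cν s z * ρ z ^ γ)
    (hu0 : ∀ z ∈ slab a b M, G.inner z (u z) (pd z 0) ≠ 0) (hL0 : ContinuousOn L0 (slab a b M))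
    (hL1 : ∀ z, L1 z 0 = 0) (hL2 : ∀ z, L2 z 0 = 0) (hL3 : ∀ z, L3 z 0 = 0)
    (hK1 : ∀ z, K1 z 0 = 0) (hK2 : ∀ z, K2 z 0 = 0) (hK3 : ∀ z, K3 z 0 = 0) :
    SolvesEuler G γ f r p ρ u := by
  have hsub : openSlab a b M ⊆ slab a b M := openSlab_subset_slab
  have hb : ∀ x : M, (b, x) ∈ slab a b M := fun x => ⟨right_mem_Icc.2 hab.le, trivial⟩
  have hmomentum : ∀ z ∈ openSlab a b M, resMomentum G f p ρ u z = 0 := fun z hz =>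
    resMomentum_eq_zero_of_tangential G hab hγ hflow hstate (hsub hz) (hu0 z (hsub hz))
      (h.entropy z hz) (h.bernoulli z hz) (h.tangential z hz)
  have hzero := residuals_eq_zero_of_openSlab G hab hγ hf' hr' hflow hstate hmomentum h.entropy
  refine solvesEuler_of_residuals_eq_zero G hab hγ hflow hstate hmomentum h.entropy
    (resMass_eq_zero_of_pressureOp G hab (zero_lt_one.trans hγ).ne' hf hr hr' hp hflow hu0
      hmomentum hL0 (fun z hz => ?_) fun x => ?_)
  · simpa only [hzero z (hsub hz), hL1, hL2, hL3, add_zero] using h.pressure z hz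
  · simpa only [hzero _ (hb x), hK1, hK2, hK3, add_zero] using h.boundary x

end Decomposition

end EulerSlab

end

open EulerSlab in
theorem theorem2p1_general {M : Type*} [TopologicalSpace M] [CompactSpace M]
    [ChartedSpace (EuclideanSpace ℝ (Fin 2)) M] [IsManifold (𝓡 2) ∞ M]
    {a b : ℝ} (hab : a < b) (G : SlabMetric a b M) {γ k₀ cν : ℝ} (hγ : 1 < γ) (_hcν : cν ≠ 0)
    {f u : VField M} {r p ρ s : ScalarField M}
    (hf : ContMDiffOn IX IX.tangent 1 f.toBundle (openSlab a b M))
    (hf' : ContinuousOn f.toBundle (slab a b M))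
    (hr : ContMDiffOn IX 𝓘(ℝ, ℝ) 1 r (openSlab a b M)) (hr' : ContinuousOn r (slab a b M))
    (hp : ContMDiffOn IX 𝓘(ℝ, ℝ) 2 p (openSlab a b M)) (hflow : IsGasFlow a b p ρ u)
    (hstate : ∀ z ∈ slab a b M, p z = entropyA k₀ cν s z * ρ z ^ γ)
    (hu0 : ∀ z ∈ slab a b M, G.inner z (u z) (pd z 0) ≠ 0)
    {L0 : ℝ × M → ℝ →L[ℝ] ℝ} (hL0 : ContinuousOn L0 (slab a b M))
    {L1 L2 : ℝ × M → ℝ → ℝ} {L3 : (z : ℝ × M) → TangentSpace IX z → ℝ}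
    (hL1 : ∀ z, L1 z 0 = 0) (hL2 : ∀ z, L2 z 0 = 0) (hL3 : ∀ z, L3 z 0 = 0)
    {K1 K2 : ℝ × M → ℝ → ℝ} {K3 : (z : ℝ × M) → TangentSpace IX z → ℝ}
    (hK1 : ∀ z, K1 z 0 = 0) (hK2 : ∀ z, K2 z 0 = 0) (hK3 : ∀ z, K3 z 0 = 0) :
    SolvesEuler G γ f r p ρ u ↔
      SolvesDecomposed G γ k₀ cν f r L0 L1 L2 L3 K1 K2 K3 p ρ s u :=
  ⟨fun h => h.solvesDecomposed G hab hγ hf hf' hr hr' hp hflow hstate hL1 hL2 hL3 hK1 hK2 hK3,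
    fun h => h.solvesEuler G hab hγ hf hf' hr hr' hp hflow hstate hu0 hL0
      hL1 hL2 hL3 hK1 hK2 hK3⟩

theorem theorem2p1 {M : Type*} [TopologicalSpace M] [T2Space M] [CompactSpace M]
    [ChartedSpace (EuclideanSpace ℝ (Fin 2)) M] [IsManifold (𝓡 2) ∞ M]
    (a b : ℝ) (hab : a < b) (G : EulerSlab.SlabMetric a b M)
    (γ k₀ cν : ℝ) (hγ : 1 < γ) (hk₀ : 0 < k₀) (hcν : 0 < cν)
    (f : EulerSlab.VField M)
    (hf : ContMDiffOn EulerSlab.IX EulerSlab.IX.tangent 1 f.toBundle (EulerSlab.openSlab a b M))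
    (hf' : ContinuousOn f.toBundle (EulerSlab.slab a b M))
    (r : EulerSlab.ScalarField M)
    (hr : ContMDiffOn EulerSlab.IX 𝓘(ℝ, ℝ) 1 r (EulerSlab.openSlab a b M))
    (hr' : ContinuousOn r (EulerSlab.slab a b M))
    (L0 : ℝ × M → ℝ →L[ℝ] ℝ) (hL0 : ContinuousOn L0 (EulerSlab.slab a b M))
    (L1 L2 : ℝ × M → ℝ → ℝ) (L3 : (z : ℝ × M) → TangentSpace EulerSlab.IX z → ℝ)
    (hL1 : ∀ z, L1 z 0 = 0) (hL2 : ∀ z, L2 z 0 = 0) (hL3 : ∀ z, L3 z 0 = 0)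
    (K1 K2 : ℝ × M → ℝ → ℝ) (K3 : (z : ℝ × M) → TangentSpace EulerSlab.IX z → ℝ)
    (hK1 : ∀ z, K1 z 0 = 0) (hK2 : ∀ z, K2 z 0 = 0) (hK3 : ∀ z, K3 z 0 = 0)
    (p ρ s : EulerSlab.ScalarField M) (u : EulerSlab.VField M)
    (hp : ContMDiffOn EulerSlab.IX 𝓘(ℝ, ℝ) 2 p (EulerSlab.openSlab a b M))
    (hp' : ContMDiffOn EulerSlab.IX 𝓘(ℝ, ℝ) 1 p (EulerSlab.slab a b M))
    (hρ : ContMDiffOn EulerSlab.IX 𝓘(ℝ, ℝ) 1 ρ (EulerSlab.slab a b M))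
    (hu : ContMDiffOn EulerSlab.IX EulerSlab.IX.tangent 1 u.toBundle (EulerSlab.slab a b M))
    (hρpos : ∀ z ∈ EulerSlab.slab a b M, 0 < ρ z)
    (hstate : ∀ z ∈ EulerSlab.slab a b M, p z = EulerSlab.entropyA k₀ cν s z * ρ z ^ γ)
    (hu0 : ∀ z ∈ EulerSlab.slab a b M, G.inner z (u z) (EulerSlab.pd z 0) ≠ 0) :
    EulerSlab.SolvesEuler G γ f r p ρ u ↔
      EulerSlab.SolvesDecomposed G γ k₀ cν f r L0 L1 L2 L3 K1 K2 K3 p ρ s u :=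
  theorem2p1_general hab G hγ hcν.ne' hf hf' hr hr' hp ⟨hp', hρ, hu, fun z hz =>
    EulerSlab.pressure_pos_of_state hk₀ (hρpos z hz) (hstate z hz), hρpos⟩ hstate hu0 hL0
    hL1 hL2 hL3 hK1 hK2 hK3
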